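/- Let $\mathcal A$ be a finite alphabet and let $\theta$ be a substitution of constant length $\ell$ on $\mathcal A$, $\theta(a)=\theta_0(a)\theta_1(a)\cdots\theta_{\ell-1}(a)$; write $(\theta^n)_i$, $0\le i<\ell^n$, for the column maps $\mathcal A\to\mathcal A$ of $\theta^n$ (so $(\theta^n)_i(a)$ is the $i$-th letter of $\theta^n(a)$, counted from $0$). A word is allowed if it occurs in some $\theta^k(a)$; $X_\theta\subset\mathcal A^{\mathbb Z}$ is the set of bi-infinite sequences all of whose finite subwords are allowed, with the product topology and the left shift $\sigma$. The column rank $c$ is the smallest cardinality of $(\theta^n)_i(\mathcal A)$, $n\ge1$, $0\le i<\ell^n$; the rank of a map is the cardinality of its image. Assume that $\theta$ is primitive (for some $k$, every letter occurs in every $\theta^k(a)$) and aperiodic ($X_\theta$ contains no $\sigma$-periodic sequence), and $c\ge2$; that $\theta$ is quasi-bijective: for some $n\ge1$ all maps $(\theta^n)_i$ have rank $c$; and that $\theta$ is simplified: every $\theta_i$ has rank $c$, and every $\theta$-periodic point of $X_\theta$ is a fixed point of $\theta$. Let $e_+=\theta_0$, $e_-=\theta_{\ell-1}$, and let $S_\theta$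 be the semigroup under composition generated by all $(\theta^n)_i$, $n\ge1$. Put $\mathcal H_+=e_+S_\theta e_+$, $\mathcal H_{-+}=e_-S_\theta e_+$, $\mathcal H_{+-}=e_+S_\theta e_-$. Then $e_+\in\mathcal H_+$, and $G_\theta:=\mathcal H_+$ is a group with neutral element $e_+$. Let $I_\theta=\{LR^{-1}: L\in\mathcal H_{-+},\ R\in\mathcal H_+,\ L=(\theta^n)_{i-1},\ R=(\theta^n)_i\text{ for some }n>0,\ 0<i<\ell^n\}$, with $R^{-1}$ the inverse of $R$ in $\mathcal H_+$. The sets $I_\theta$ and $\mathcal H_{+-}$ are nonempty. For $\phi\in\mathcal H_{+-}$ let $A_\phi$ be the $\{\pm\}\times I_\theta$ matrix with entries $a_{+\,\mathfrak i}=e_+$ and $a_{-\,\mathfrak i}=\phi\,\mathfrak i$ in $G_\theta$, and let $M(I_\theta,G_\theta,\{\pm\};A_\phi)$ be the set $I_\theta\times G_\theta\times\{\pm\}$ with the product $(\mathfrak i,g,\epsilon)(\mathfrak j,h,\epsilon')=(\mathfrak i,\,g\,a_{\epsilon\,\mathfrak j}\,h,\,\epsilon')$. The map $x\mapsto x_{-1}x_0$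 is a bijection from the set of fixed points of $\theta$ in $X_\theta$ onto the set of allowed words $ab$ with $a\in\operatorname{im}e_-$, $b\in\operatorname{im}e_+$; write $a\cdot b$ for the fixed point corresponding to $ab$. There is a unique factor map $\pi_{eq}$ from $(X_\theta,\sigma)$ onto the $\ell$-adic integers $(\varprojlim\mathbb Z/\ell^n\mathbb Z,+1)$ such that $\pi_{eq}^{-1}(0)$ is the set of fixed points of $\theta$. Let $E(X_\theta)$ be the Ellis semigroup, that is, the closure of $\{\sigma^t:t\in\mathbb Z\}$ in the set of all maps $X_\theta\to X_\theta$ for pointwise convergence, let $\mathcal M(X_\theta)$ be its kernel (smallest bilateral ideal), let $\mathcal M^{fib}(X_\theta)$ be the set of those $f\in\mathcal M(X_\theta)$ with $\pi_{eq}\circ f=\pi_{eq}$, and let $\mathcal M^{fib}_0(X_\theta)$ be the semigroup under composition of the restrictions of its elements to $\pi_{eq}^{-1}(0)$. Then for every $\phi\in\mathcal H_{+-}$, the map $(\mathfrak i,g,\epsilon)\mapsto f_{(\mathfrak i,g,\epsilon)}$ given by $f_{(\mathfrak i,g,+)}(a\cdot b)=\mathfrak i g(b)\cdot g(b)$, $f_{(\mathfrak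 i,g,-)}(a\cdot b)=\mathfrak i g\phi(a)\cdot g\phi(a)$ is well defined and is an isomorphism of semigroups from $M(I_\theta,G_\theta,\{\pm\};A_\phi)$ onto $\mathcal M^{fib}_0(X_\theta)$. -/

import Mathlib

namespace QuasiBij

/-! ### Rees matrix semigroups -/

/-- The underlying set `I × G × Λ` of the matrix semigroup with `Λ × I` sandwich matrix `M`. -/
@[ext]
structure ReesMatrix {I G Λ : Type*} (M : Λ → I → G) where
  row : I
  val : G
  col : Λ

/-- `(i, g, lam) (j, h, mu) = (i, g * M lam j * h, mu)`. -/
instance {I G Λ : Type*} [Semigroup G] (M : Λ → I → G) : Mul (ReesMatrix M) where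
  mul x y := ⟨x.row, x.val * M x.col y.row * y.val, y.col⟩

instance {I G Λ : Type*} [Semigroup G] (M : Λ → I → G) : Semigroup (ReesMatrix M) where
  mul_assoc x y z := by
    change ReesMatrix.mk x.row (x.val * M x.col y.row * y.val * M y.col z.row * z.val) z.col =
      ReesMatrix.mk x.row (x.val * M x.col y.row * (y.val * M y.col z.row * z.val)) z.col
    simp only [mul_assoc]

/-- The semigroup `G` is a group with neutral element `e`. -/
def IsGroupWithOne {G : Type*} [Semigroup G] (e : G) : Prop :=
  (∀ g, e * g = g ∧ g * e = g) ∧ ∀ g, ∃ h, g * h = e ∧ h * g = e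

/-- The two-element index set `{+, -}`. -/
inductive PM
  | plus
  | minus

/-! ### The Ellis semigroup of a `ℤ`-action and its kernel -/

section Ellis

variable {X : Type*} [TopologicalSpace X]

/-- The Ellis semigroup: the closure of `{σ ^ t : t ∈ ℤ}` in `X → X` for the topology of
pointwise convergence. The product of the semigroup is composition. -/
def ellis (σ : ℤ → X → X) : Set (X → X) := closure (Set.range σ)

/-- `J` is a (nonempty) bilateral ideal of the semigroup of maps `E`. -/
def IsBilateralIdeal (E J : Set (X → X)) : Prop :=
  J.Nonempty ∧ J ⊆ E ∧ ∀ f ∈ E, ∀ j ∈ J, f ∘ j ∈ J ∧ j ∘ f ∈ J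

/-- The kernel: the smallest bilateral ideal, that is, the intersection of all of them. -/
def kernel (E : Set (X → X)) : Set (X → X) :=
  {f | f ∈ E ∧ ∀ J, IsBilateralIdeal E J → f ∈ J}

theorem ellis_comp {σ : ℤ → X → X} (hc : ∀ t, Continuous (σ t))
    (hadd : ∀ s t, σ s ∘ σ t = σ (s + t)) {f g : X → X}
    (hf : f ∈ ellis σ) (hg : g ∈ ellis σ) : f ∘ g ∈ ellis σ := by
  have h1 : ∀ t, σ t ∘ g ∈ ellis σ := by
    intro t
    have hcont : Continuous fun k : X → X => σ t ∘ k :=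
      continuous_pi fun x => (hc t).comp (continuous_apply x)
    refine map_mem_closure hcont hg ?_
    rintro _ ⟨s, rfl⟩
    exact ⟨t + s, (hadd t s).symm⟩
  have hcont : Continuous fun k : X → X => k ∘ g :=
    continuous_pi fun x => continuous_apply (g x)
  have h2 : f ∘ g ∈ closure (ellis σ) := by
    refine map_mem_closure (f := fun k : X → X => k ∘ g) hcont hf ?_
    rintro _ ⟨s, rfl⟩
    exact h1 s
  rwa [ellis, closure_closure] at h2

end Ellis

/-! ### The `ℓ`-adic integers -/

/-- The inverse limit of the rings `ℤ / ℓ ^ n ℤ` (with the topology induced by the product of the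
discrete topologies). -/
def ladicInt (ℓ : ℕ) : Subring (∀ n : ℕ, ZMod (ℓ ^ n)) where
  carrier := {z | ∀ n, ZMod.castHom (pow_dvd_pow ℓ n.le_succ) (ZMod (ℓ ^ n)) (z (n + 1)) = z n}
  mul_mem' ha hb n := by rw [Pi.mul_apply, map_mul, ha n, hb n, Pi.mul_apply]
  one_mem' n := by rw [Pi.one_apply, map_one, Pi.one_apply]
  add_mem' ha hb n := by rw [Pi.add_apply, map_add, ha n, hb n, Pi.add_apply]
  zero_mem' n := by rw [Pi.zero_apply, map_zero, Pi.zero_apply]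
  neg_mem' ha n := by rw [Pi.neg_apply, map_neg, ha n, Pi.neg_apply]

/-! ### Substitutions of constant length

A substitution of constant length `ℓ` on the alphabet `A` is a map `θ : A → Fin ℓ → A`: the word
`θ a` has the letters `θ a 0, …, θ a (ℓ - 1)`. -/

section Substitution

variable {A : Type*} {ℓ : ℕ}

/-- The extension of `θ` to finite words by concatenation. -/
def wordMap (θ : A → Fin ℓ → A) (w : List A) : List A := w.flatMap fun a => List.ofFn (θ a)

/-- The word `θ ^ n (a)`. -/
def powWord (θ : A → Fin ℓ → A) (n : ℕ) (a : A) : List A := (wordMap θ)^[n] [a]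

theorem length_wordMap (θ : A → Fin ℓ → A) (w : List A) :
    (wordMap θ w).length = w.length * ℓ := by
  simp [wordMap, List.length_flatMap]

theorem length_powWord (θ : A → Fin ℓ → A) (n : ℕ) (a : A) :
    (powWord θ n a).length = ℓ ^ n := by
  induction n with
  | zero => simp [powWord]
  | succ n ih =>
    rw [powWord, Function.iterate_succ_apply', length_wordMap, ← powWord, ih, pow_succ]

def IsPrimitive (θ : A → Fin ℓ → A) : Prop := ∃ k, ∀ a a', a' ∈ powWord θ k a

/-- `w` occurs in some word `θ ^ k (a)`. -/
def Allowed (θ : A → Fin ℓ → A) (w : List A) : Prop := ∃ a k, w <:+: powWord θ k a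

/-- The shift space: the bi-infinite sequences all of whose finite subwords are allowed. -/
def shiftSpace (θ : A → Fin ℓ → A) : Set (ℤ → A) :=
  {x | ∀ (i : ℤ) (n : ℕ), Allowed θ (List.ofFn fun j : Fin n => x (i + (j : ℕ)))}

/-- The `t`-th power of the left shift on the shift space. -/
def shift (θ : A → Fin ℓ → A) (t : ℤ) (x : shiftSpace θ) : shiftSpace θ :=
  ⟨fun i => x.1 (i + t), fun i n => by
    have h := x.2 (i + t) n
    simpa only [add_right_comm] using h⟩

theorem continuous_shift [TopologicalSpace A] (θ : A → Fin ℓ → A) (t : ℤ) :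
    Continuous (shift θ t) := by
  refine Continuous.subtype_mk (continuous_pi fun i => ?_) _
  exact (continuous_apply (i + t)).comp continuous_subtype_val

theorem shift_comp (θ : A → Fin ℓ → A) (s t : ℤ) : shift θ s ∘ shift θ t = shift θ (s + t) := by
  funext x
  apply Subtype.ext
  funext i
  change x.1 (i + s + t) = x.1 (i + (s + t))
  rw [add_assoc]

/-- The shift space contains no shift-periodic sequence. -/
def IsAperiodic (θ : A → Fin ℓ → A) : Prop :=
  ∀ (x : shiftSpace θ) (p : ℤ), p ≠ 0 → shift θ p x ≠ x

/-- The `i`-th column map of `θ ^ n`: it sends `a` to the `i`-th letter of `θ ^ n (a)`. -/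
def column (θ : A → Fin ℓ → A) (n : ℕ) (i : Fin (ℓ ^ n)) : Function.End A :=
  fun a => (powWord θ n a)[(i : ℕ)]'(by rw [length_powWord]; exact i.2)

/-- The rank of a self-map of the alphabet: the cardinality of its image. -/
noncomputable def rank (s : Function.End A) : ℕ := (Set.range fun a : A => s a).ncard

/-- The column rank of `θ`: the least rank of a column map of a power of `θ`. -/
noncomputable def columnRank (θ : A → Fin ℓ → A) : ℕ :=
  sInf {r | ∃ n, 1 ≤ n ∧ ∃ j : Fin (ℓ ^ n), rank (column θ n j) = r}

def IsQuasiBijective (θ : A → Fin ℓ → A) : Prop :=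
  ∃ n, 1 ≤ n ∧ ∀ i, rank (column θ n i) = columnRank θ

variable [NeZero ℓ]

/-- The action of `θ` on bi-infinite sequences: `θ (x q)` is placed at `[ℓ q, ℓ q + ℓ)`. -/
def substSeq (θ : A → Fin ℓ → A) (x : ℤ → A) (i : ℤ) : A :=
  θ (x (i / ℓ)) ⟨(i % ℓ).toNat, by
    have h : (0 : ℤ) < ℓ := by exact_mod_cast Nat.pos_of_ne_zero (NeZero.ne ℓ)
    have h1 := Int.emod_nonneg i h.ne'
    have h2 := Int.emod_lt_of_pos i h
    omega⟩

/-- Simplified form: every column map of `θ` has rank `columnRank θ`, and every `θ`-periodic point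
of the shift space is a fixed point of `θ`. -/
structure IsSimplified (θ : A → Fin ℓ → A) : Prop where
  rank_column : ∀ i : Fin ℓ, rank (fun a => θ a i : Function.End A) = columnRank θ
  fixed_of_periodic : ∀ x ∈ shiftSpace θ, ∀ n, 1 ≤ n → (substSeq θ)^[n] x = x → substSeq θ x = x

/-- `e₊ = θ_0`. -/
def ePlus (θ : A → Fin ℓ → A) : Function.End A :=
  fun a => θ a ⟨0, Nat.pos_of_ne_zero (NeZero.ne ℓ)⟩

/-- `e₋ = θ_(ℓ - 1)`. -/
def eMinus (θ : A → Fin ℓ → A) : Function.End A :=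
  fun a => θ a ⟨ℓ - 1, Nat.sub_lt (Nat.pos_of_ne_zero (NeZero.ne ℓ)) one_pos⟩

/-- The pairs `(a, b)` with `a ∈ im e₋`, `b ∈ im e₊` and `ab` an allowed word. -/
def twoLetter (θ : A → Fin ℓ → A) : Set (A × A) :=
  {p | (∃ c, eMinus θ c = p.1) ∧ (∃ c, ePlus θ c = p.2) ∧ Allowed θ [p.1, p.2]}

/-! ### The semigroup of a substitution -/

/-- The semigroup `S` of self-maps of the alphabet generated by the column maps of all `θ ^ n`,
`n ≥ 1`, under composition. -/
def colSemigroup (θ : A → Fin ℓ → A) : Subsemigroup (Function.End A) :=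
  Subsemigroup.closure {s | ∃ n, 1 ≤ n ∧ ∃ i, s = column θ n i}

theorem ePlus_mem (θ : A → Fin ℓ → A) : ePlus θ ∈ colSemigroup θ := by
  refine Subsemigroup.subset_closure ⟨1, le_rfl, ⟨0, by simp [Nat.pos_of_ne_zero (NeZero.ne ℓ)]⟩, ?_⟩
  funext a
  simp [ePlus, column, powWord, wordMap]

theorem eMinus_mem (θ : A → Fin ℓ → A) : eMinus θ ∈ colSemigroup θ := by
  refine Subsemigroup.subset_closure ⟨1, le_rfl,
    ⟨ℓ - 1, by simp [Nat.pos_of_ne_zero (NeZero.ne ℓ)]⟩, ?_⟩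
  funext a
  simp [eMinus, column, powWord, wordMap]

/-- `e S f`. For idempotents `e`, `f` of `S` this is the intersection of the right ideal `e S`
with the left ideal `S f`. -/
def corner (θ : A → Fin ℓ → A) (e f : Function.End A) : Set (Function.End A) :=
  {s | ∃ t ∈ colSemigroup θ, s = e * t * f}

/-- The structure group `G = ℋ₊ = e₊ S e₊` of `θ`, under composition. -/
def structureGroup (θ : A → Fin ℓ → A) : Subsemigroup (Function.End A) where
  carrier := corner θ (ePlus θ) (ePlus θ)
  mul_mem' := by
    rintro _ _ ⟨s, hs, rfl⟩ ⟨t, ht, rfl⟩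
    refine ⟨s * (ePlus θ * ePlus θ) * t, mul_mem (mul_mem hs (mul_mem ?_ ?_)) ht, ?_⟩
    · exact ePlus_mem θ
    · exact ePlus_mem θ
    · simp only [mul_assoc]

/-- `L = (θ ^ n)_(i - 1)` and `R = (θ ^ n)_i` for some `n > 0` and `i > 0`. -/
def Consecutive (θ : A → Fin ℓ → A) (L R : Function.End A) : Prop :=
  ∃ n, 0 < n ∧ ∃ (i : ℕ) (h : i + 1 < ℓ ^ n),
    L = column θ n ⟨i, Nat.lt_of_succ_lt h⟩ ∧ R = column θ n ⟨i + 1, h⟩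

/-- The pairs of consecutive elements in `ℋ₋₊ × ℋ₊`, where `ℋ₋₊ = e₋ S e₊`. -/
def consecutivePairs (θ : A → Fin ℓ → A) : Set (Function.End A × Function.End A) :=
  {p | Consecutive θ p.1 p.2 ∧ p.1 ∈ corner θ (eMinus θ) (ePlus θ) ∧ p.2 ∈ structureGroup θ}

/-- The set `I` of all `L * R⁻¹`, where `(L, R)` is a consecutive pair in `ℋ₋₊ × ℋ₊` and `R⁻¹`
(here `Q`) is the inverse of `R` in the group `ℋ₊`, whose neutral element is `e₊`. -/
def rowSet (θ : A → Fin ℓ → A) : Set (Function.End A) :=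
  {s | ∃ L R Q, (L, R) ∈ consecutivePairs θ ∧ Q ∈ structureGroup θ ∧
    R * Q = ePlus θ ∧ Q * R = ePlus θ ∧ s = L * Q}

theorem mul_rowSet_mem (θ : A → Fin ℓ → A) {φ s : Function.End A}
    (hφ : φ ∈ corner θ (ePlus θ) (eMinus θ)) (hs : s ∈ rowSet θ) :
    φ * s ∈ structureGroup θ := by
  obtain ⟨p, hp, rfl⟩ := hφ
  obtain ⟨L, R, Q, ⟨-, ⟨q, hq, hL⟩, -⟩, ⟨r, hr, hQ⟩, -, -, rfl⟩ := hs
  change L = _ at hL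
  have hplus := ePlus_mem θ
  have hminus := eMinus_mem θ
  refine ⟨p * (eMinus θ * eMinus θ) * q * (ePlus θ * ePlus θ) * r,
    mul_mem (mul_mem (mul_mem (mul_mem hp (mul_mem hminus hminus)) hq) (mul_mem hplus hplus)) hr,
    ?_⟩
  rw [hL, hQ]
  simp only [mul_assoc]

/-- The sandwich matrix `A_φ`, for `φ ∈ ℋ₊₋ = e₊ S e₋`: the entries of the row `+` are `e₊`, and
the entry `(-, i)` is `φ i`. -/
def sandwich (θ : A → Fin ℓ → A) (he : ePlus θ ∈ structureGroup θ)
    (φ : corner θ (ePlus θ) (eMinus θ)) : PM → rowSet θ → structureGroup θ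
  | PM.plus, _ => ⟨ePlus θ, he⟩
  | PM.minus, i => ⟨φ.1 * i.1, mul_rowSet_mem θ φ.2 i.2⟩

/-! ### The factor map to the `ℓ`-adic integers and the fibre-preserving kernel -/

variable [TopologicalSpace A]

/-- `π` is a factor map from the shift space with the shift to the `ℓ`-adic integers with `+ 1`
whose fibre over `0` is the set of fixed points of `θ`. -/
structure IsFactorMap (θ : A → Fin ℓ → A) (π : shiftSpace θ → ladicInt ℓ) : Prop where
  continuous : Continuous π
  surjective : Function.Surjective π
  equivariant : ∀ x, π (shift θ 1 x) = π x + 1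
  zero_iff : ∀ x : shiftSpace θ, π x = 0 ↔ substSeq θ x.1 = x.1

/-- The elements of the kernel of the Ellis semigroup which preserve all fibres of `π`. -/
def kernelFib (θ : A → Fin ℓ → A) (π : shiftSpace θ → ladicInt ℓ) :
    Set (shiftSpace θ → shiftSpace θ) :=
  {f | f ∈ kernel (ellis (shift θ)) ∧ ∀ x, π (f x) = π x}

/-- The restrictions to the fibre of `π` over `0` of the elements of `kernelFib`, a semigroup
under composition. -/
def kernelFibZero (θ : A → Fin ℓ → A) (π : shiftSpace θ → ladicInt ℓ) :
    Subsemigroup (Function.End {x : shiftSpace θ // π x = 0}) where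
  carrier := {g | ∃ f ∈ kernelFib θ π, ∀ x, (g x).1 = f x.1}
  mul_mem' := by
    rintro g g' ⟨f, ⟨⟨hfE, hfk⟩, hfπ⟩, hf⟩ ⟨f', ⟨⟨hfE', hfk'⟩, hfπ'⟩, hf'⟩
    refine ⟨f ∘ f', ⟨⟨?_, ?_⟩, ?_⟩, ?_⟩
    · exact ellis_comp (continuous_shift θ) (shift_comp θ) hfE hfE'
    · intro J hJ
      exact (hJ.2.2 f hfE f' (hfk' J hJ)).1
    · intro x
      exact (hfπ (f' x)).trans (hfπ' x)
    · intro x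
      have h1 : ((g * g') x).1 = f (g' x).1 := hf (g' x)
      rw [h1, hf' x]
      rfl

end Substitution

end QuasiBij

open QuasiBij

namespace QuasiBij

section Columns

variable {A : Type*} {ℓ : ℕ} [NeZero ℓ]

/-- The column map of `θ` at the residue class of `i` modulo `ℓ`. -/
def digit (θ : A → Fin ℓ → A) (i : ℤ) : Function.End A := fun a => substSeq θ (fun _ => a) i

/-- The column map of `θ ^ n` at the residue class of `i` modulo `ℓ ^ n`. -/
def col (θ : A → Fin ℓ → A) : ℕ → ℤ → Function.End A
  | 0, _ => 1
  | n + 1, i => digit θ i * col θ n (i / ℓ)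

variable (θ : A → Fin ℓ → A)

theorem length_pos : (0 : ℤ) < ℓ := by exact_mod_cast Nat.pos_of_ne_zero (NeZero.ne ℓ)

theorem length_pow_pos (n : ℕ) : (0 : ℤ) < (ℓ : ℤ) ^ n := pow_pos length_pos n

theorem neg_one_ediv_of_pos {b : ℤ} (hb : 0 < b) : -1 / b = -1 := by
  rw [Int.neg_one_ediv, Int.sign_eq_one_of_pos hb]

theorem substSeq_apply (x : ℤ → A) (i : ℤ) : substSeq θ x i = digit θ i (x (i / ℓ)) := rfl

theorem digit_congr {i j : ℤ} (h : (ℓ : ℤ) ∣ i - j) : digit θ i = digit θ j := by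
  have h : i % ℓ = j % ℓ := (Int.modEq_iff_dvd.2 h).symm
  funext a
  simp only [digit, substSeq, h]

theorem digit_natCast (i : Fin ℓ) (a : A) : digit θ (i : ℕ) a = θ a i := by
  have h : (((i : ℕ) : ℤ) % ℓ).toNat = i := by
    rw [← Int.natCast_mod, Int.toNat_natCast, Nat.mod_eq_of_lt i.2]
  simp only [digit, substSeq]
  congr 1
  exact Fin.ext h

theorem ePlus_eq_digit : ePlus θ = digit θ 0 := by
  funext a
  simp [digit, substSeq, ePlus]

theorem eMinus_eq_digit : eMinus θ = digit θ (-1) := by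
  have hl : 0 < ℓ := Nat.pos_of_ne_zero (NeZero.ne ℓ)
  have h : (ℓ : ℤ) ∣ -1 - ((ℓ - 1 : ℕ) : ℤ) := by
    rw [Nat.cast_sub hl, Nat.cast_one]
    exact ⟨-1, by ring⟩
  rw [digit_congr θ h]
  funext a
  exact (digit_natCast θ ⟨ℓ - 1, Nat.sub_lt hl one_pos⟩ a).symm

@[simp] theorem col_zero (i : ℤ) : col θ 0 i = 1 := rfl

theorem col_succ (n : ℕ) (i : ℤ) : col θ (n + 1) i = digit θ i * col θ n (i / ℓ) := rfl

@[simp] theorem col_one (i : ℤ) : col θ 1 i = digit θ i := mul_one _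

theorem ediv_length_pow_succ (i : ℤ) (n : ℕ) : i / (ℓ : ℤ) ^ (n + 1) = i / ℓ / (ℓ : ℤ) ^ n := by
  rw [pow_succ', Int.ediv_ediv_of_nonneg length_pos.le]

theorem iterate_substSeq (n : ℕ) (x : ℤ → A) (i : ℤ) :
    (substSeq θ)^[n] x i = col θ n i (x (i / (ℓ : ℤ) ^ n)) := by
  induction n generalizing i with
  | zero => rw [pow_zero, Int.ediv_one]; rfl
  | succ n ih =>
    rw [Function.iterate_succ_apply', substSeq_apply, ih, col_succ, ediv_length_pow_succ]
    rfl

theorem col_add (m n : ℕ) (i : ℤ) :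
    col θ (m + n) i = col θ n i * col θ m (i / (ℓ : ℤ) ^ n) := by
  induction n generalizing i with
  | zero => simp
  | succ n ih => rw [← add_assoc, col_succ, ih, col_succ, ediv_length_pow_succ, mul_assoc]

theorem col_add_apply (m n : ℕ) (i : ℤ) (a : A) :
    col θ n i (col θ m (i / (ℓ : ℤ) ^ n) a) = col θ (m + n) i a :=
  (congrFun (col_add θ m n i) a).symm

theorem col_congr {n : ℕ} {i j : ℤ} (h : (ℓ : ℤ) ^ n ∣ i - j) : col θ n i = col θ n j := by
  induction n generalizing i j with
  | zero => rfl
  | succ n ih =>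
    obtain ⟨k, hk⟩ := h
    have hi : i = j + ℓ * ((ℓ : ℤ) ^ n * k) := by rw [pow_succ'] at hk; linear_combination hk
    rw [col_succ, col_succ, digit_congr θ (i := i) (j := j) ⟨(ℓ : ℤ) ^ n * k, by rw [hi]; ring⟩]
    congr 1
    apply ih
    rw [hi, Int.add_mul_ediv_left _ _ length_pos.ne']
    exact ⟨k, by ring⟩

theorem col_emod (n : ℕ) (i : ℤ) : col θ n (i % (ℓ : ℤ) ^ n) = col θ n i := by
  apply col_congr
  rw [← neg_sub, dvd_neg]
  exact Int.dvd_self_sub_emod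

theorem neg_one_ediv_length_pow (n : ℕ) : (-1 : ℤ) / (ℓ : ℤ) ^ n = -1 :=
  neg_one_ediv_of_pos (length_pow_pos n)

theorem col_zero_right (n : ℕ) : col θ n 0 = ePlus θ ^ n := by
  induction n with
  | zero => rfl
  | succ n ih => rw [col_succ, Int.zero_ediv, ih, ePlus_eq_digit, pow_succ']

theorem col_neg_one (n : ℕ) : col θ n (-1) = eMinus θ ^ n := by
  induction n with
  | zero => rfl
  | succ n ih =>
    rw [col_succ, neg_one_ediv_of_pos length_pos, ih, eMinus_eq_digit, pow_succ']

theorem col_mul_col (m n : ℕ) (i j : ℤ) :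
    col θ n i * col θ m j = col θ (m + n) (j * (ℓ : ℤ) ^ n + i % (ℓ : ℤ) ^ n) := by
  have h := length_pow_pos (ℓ := ℓ) n
  rw [col_add, add_comm (j * _), Int.add_mul_ediv_right _ _ h.ne',
    Int.ediv_eq_zero_of_lt (Int.emod_nonneg _ h.ne') (Int.emod_lt_of_pos _ h), zero_add]
  congr 1
  rw [← col_emod θ n i]
  apply col_congr
  exact ⟨-j, by ring⟩

theorem col_col_apply (m n : ℕ) (i j : ℤ) (a : A) :
    col θ n i (col θ m j a) = col θ (m + n) (j * (ℓ : ℤ) ^ n + i % (ℓ : ℤ) ^ n) a :=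
  congrFun (col_mul_col θ m n i j) a

theorem getElem?_wordMap (w : List A) (k : ℕ) :
    (wordMap θ w)[k]? = w[k / ℓ]?.map (digit θ k) := by
  have hl : 0 < ℓ := Nat.pos_of_ne_zero (NeZero.ne ℓ)
  induction w generalizing k with
  | nil => rfl
  | cons a w ih =>
    have hw : wordMap θ (a :: w) = List.ofFn (θ a) ++ wordMap θ w := by simp [wordMap]
    rw [hw, List.getElem?_append]
    split_ifs with h
    · rw [List.length_ofFn] at h
      rw [Nat.div_eq_of_lt h, List.getElem?_ofFn, dif_pos h]
      rw [List.getElem?_cons_zero]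
      congr 1
      exact (digit_natCast θ ⟨k, h⟩ a).symm
    · rw [List.length_ofFn, not_lt] at h
      obtain ⟨m, rfl⟩ := Nat.exists_eq_add_of_le h
      rw [List.length_ofFn, Nat.add_sub_cancel_left, ih, Nat.add_div_left _ hl,
        List.getElem?_cons_succ, digit_congr θ (i := ((ℓ + m : ℕ) : ℤ)) (j := (m : ℤ))]
      exact ⟨1, by push_cast; ring⟩

theorem getElem?_powWord (n : ℕ) (a : A) {k : ℕ} (hk : k < ℓ ^ n) :
    (powWord θ n a)[k]? = some (col θ n k a) := by
  induction n generalizing k with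
  | zero =>
    have : k = 0 := by simpa using hk
    subst this
    rfl
  | succ n ih =>
    rw [powWord, Function.iterate_succ_apply', ← powWord, getElem?_wordMap,
      ih (Nat.div_lt_of_lt_mul (by rwa [← pow_succ'])), col_succ, Int.natCast_div]
    rfl

theorem column_eq_col (n : ℕ) (i : Fin (ℓ ^ n)) : column θ n i = col θ n (i : ℕ) := by
  funext a
  have h := getElem?_powWord θ n a i.2
  rw [List.getElem?_eq_getElem (by rw [length_powWord]; exact i.2)] at h
  exact Option.some_injective _ h

theorem mem_powWord {n : ℕ} {a b : A} :
    b ∈ powWord θ n a ↔ ∃ i : ℤ, 0 ≤ i ∧ i < (ℓ : ℤ) ^ n ∧ col θ n i a = b := by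
  rw [List.mem_iff_getElem]
  constructor
  · rintro ⟨i, hi, rfl⟩
    rw [length_powWord] at hi
    exact ⟨i, by positivity, by exact_mod_cast hi, (congrFun (column_eq_col θ n ⟨i, hi⟩) a).symm⟩
  · rintro ⟨i, hi0, hi, rfl⟩
    lift i to ℕ using hi0
    have hi : i < ℓ ^ n := by exact_mod_cast hi
    exact ⟨i, by rwa [length_powWord], congrFun (column_eq_col θ n ⟨i, hi⟩) a⟩

theorem allowed_ofFn_iff {n : ℕ} {w : Fin n → A} :
    Allowed θ (List.ofFn w) ↔ ∃ (a : A) (k : ℕ) (p : ℤ), 0 ≤ p ∧ p + n ≤ (ℓ : ℤ) ^ k ∧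
      ∀ j : Fin n, w j = col θ k (p + (j : ℕ)) a := by
  constructor
  · rintro ⟨a, k, s, t, hst⟩
    have hlen := congrArg List.length hst
    simp only [List.length_append, List.length_ofFn, length_powWord] at hlen
    refine ⟨a, k, s.length, by positivity, by exact_mod_cast (by omega), fun j => ?_⟩
    have hj := j.2
    have h := getElem?_powWord θ k a (k := s.length + j) (by omega)
    rw [← hst, List.append_assoc, List.getElem?_append_right (by omega), Nat.add_sub_cancel_left,
      List.getElem?_append_left (by simp), List.getElem?_ofFn, dif_pos j.2] at h
    simpa using h
  · rintro ⟨a, k, p, hp, hpn, hw⟩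
    lift p to ℕ using hp
    have hpn : p + n ≤ ℓ ^ k := by exact_mod_cast hpn
    have h : List.ofFn w = ((powWord θ k a).drop p).take n := by
      apply List.ext_getElem?
      intro j
      by_cases hj : j < n
      · rw [List.getElem?_take_of_lt hj, List.getElem?_drop, getElem?_powWord θ k a (by omega),
          List.getElem?_ofFn, dif_pos hj, hw]
        push_cast
        rfl
      · rw [List.getElem?_eq_none (by simpa using hj),
          List.getElem?_eq_none (by simp; omega)]
    rw [h]
    exact ⟨a, k, (List.take_prefix _ _).isInfix.trans (List.drop_suffix _ _).isInfix⟩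

theorem allowed_pair_iff {b c : A} :
    Allowed θ [b, c] ↔ ∃ (a : A) (k : ℕ) (p : ℤ), 0 ≤ p ∧ p + 1 < (ℓ : ℤ) ^ k ∧
      b = col θ k p a ∧ c = col θ k (p + 1) a := by
  have h : [b, c] = List.ofFn ![b, c] := by simp
  rw [h, allowed_ofFn_iff]
  refine exists_congr fun a => exists_congr fun k => exists_congr fun p => ?_
  rw [Fin.forall_fin_two]
  simp only [Matrix.cons_val_zero, Matrix.cons_val_one, Fin.val_zero, Fin.val_one]
  push_cast
  rw [add_zero, ← Int.add_one_le_iff, add_assoc]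
  rfl

theorem mem_shiftSpace_iff {x : ℤ → A} :
    x ∈ shiftSpace θ ↔ ∀ (i : ℤ) (n : ℕ), ∃ (a : A) (k : ℕ) (p : ℤ), 0 ≤ p ∧
      p + n ≤ (ℓ : ℤ) ^ k ∧ ∀ j : ℤ, 0 ≤ j → j < n → x (i + j) = col θ k (p + j) a := by
  refine forall_congr' fun i => forall_congr' fun n => (allowed_ofFn_iff θ).trans ?_
  refine exists_congr fun a => exists_congr fun k => exists_congr fun p => ?_
  refine and_congr_right fun _ => and_congr_right fun _ => ⟨fun h j hj hjn => ?_, fun h j => ?_⟩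
  · lift j to ℕ using hj
    exact h ⟨j, by exact_mod_cast hjn⟩
  · exact h _ (by positivity) (by exact_mod_cast j.2)

theorem mem_colSemigroup_iff {s : Function.End A} :
    s ∈ colSemigroup θ ↔ ∃ n, 1 ≤ n ∧ ∃ i : ℤ, s = col θ n i := by
  constructor
  · intro hs
    induction hs using Subsemigroup.closure_induction with
    | mem s hs =>
      obtain ⟨n, hn, i, rfl⟩ := hs
      exact ⟨n, hn, i, column_eq_col θ n i⟩
    | mul s t _ _ ihs iht =>
      obtain ⟨n, hn, i, rfl⟩ := ihs
      obtain ⟨m, hm, j, rfl⟩ := iht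
      exact ⟨m + n, by omega, _, col_mul_col θ m n i j⟩
  · rintro ⟨n, hn, i, rfl⟩
    have h := length_pow_pos (ℓ := ℓ) n
    apply Subsemigroup.subset_closure
    have h0 := Int.emod_nonneg i h.ne'
    have h1 := Int.emod_lt_of_pos i h
    rw [← col_emod]
    lift i % (ℓ : ℤ) ^ n to ℕ using h0 with j
    have h1 : j < ℓ ^ n := by exact_mod_cast h1
    exact ⟨n, hn, ⟨j, h1⟩, (column_eq_col θ n ⟨j, h1⟩).symm⟩

theorem consecutive_iff {L R : Function.End A} :
    Consecutive θ L R ↔ ∃ n, 0 < n ∧ ∃ k : ℤ, ¬ (ℓ : ℤ) ^ n ∣ k ∧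
      L = col θ n (k - 1) ∧ R = col θ n k := by
  constructor
  · rintro ⟨n, hn, i, hi, rfl, rfl⟩
    refine ⟨n, hn, i + 1, fun h => ?_, ?_, ?_⟩
    · have := Int.le_of_dvd (by positivity) h
      have hi : (i : ℤ) + 1 < (ℓ : ℤ) ^ n := by exact_mod_cast hi
      omega
    · rw [column_eq_col, add_sub_cancel_right]
    · rw [column_eq_col]
      push_cast
      rfl
  · rintro ⟨n, hn, k, hk, rfl, rfl⟩
    have h := length_pow_pos (ℓ := ℓ) n
    have h0 := Int.emod_nonneg k h.ne'
    have h1 := Int.emod_lt_of_pos k h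
    have h2 : k % (ℓ : ℤ) ^ n ≠ 0 := fun h => hk (Int.dvd_of_emod_eq_zero h)
    have h3 : (ℓ : ℤ) ^ n ∣ k - k % (ℓ : ℤ) ^ n := Int.dvd_self_sub_emod
    generalize k % (ℓ : ℤ) ^ n = r at *
    obtain ⟨i, rfl⟩ : ∃ i : ℕ, r = i + 1 := ⟨(r - 1).toNat, by omega⟩
    refine ⟨n, hn, i, by exact_mod_cast h1, ?_, ?_⟩
    · rw [column_eq_col]
      apply col_congr
      convert h3 using 1
      ring
    · rw [column_eq_col]
      apply col_congr
      push_cast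
      exact h3

theorem Consecutive.mul {L R s : Function.End A} (h : Consecutive θ L R)
    (hs : s ∈ colSemigroup θ) : Consecutive θ (L * s) (R * s) := by
  rw [consecutive_iff] at h ⊢
  rw [mem_colSemigroup_iff] at hs
  obtain ⟨n, hn, k, hk, rfl, rfl⟩ := h
  obtain ⟨m, hm, j, rfl⟩ := hs
  have hpos := length_pow_pos (ℓ := ℓ) n
  have h0 := Int.emod_nonneg k hpos.ne'
  have h1 := Int.emod_lt_of_pos k hpos
  have h2 : k % (ℓ : ℤ) ^ n ≠ 0 := fun h => hk (Int.dvd_of_emod_eq_zero h)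
  refine ⟨m + n, by omega, j * (ℓ : ℤ) ^ n + k % (ℓ : ℤ) ^ n, fun h => ?_, ?_, col_mul_col ..⟩
  · have h := (Dvd.intro_left _ (pow_add (ℓ : ℤ) m n).symm).trans h
    rw [dvd_add_right (dvd_mul_left _ _)] at h
    exact h2 (by rw [← Int.emod_eq_zero_of_dvd h, Int.emod_emod])
  · rw [col_mul_col]
    congr 1
    rw [add_sub_assoc]
    congr 1
    rw [← Int.emod_sub_emod, Int.emod_eq_of_lt (by omega) (by omega)]

/-- The column maps at the two sides of a position `ℓ * m`. -/
theorem ePlus_mul_col (n : ℕ) (m : ℤ) : ePlus θ * col θ n m = col θ (n + 1) (ℓ * m) := by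
  rw [col_succ, Int.mul_ediv_cancel_left _ length_pos.ne', ePlus_eq_digit,
    digit_congr θ (i := ℓ * m) (j := 0) ⟨m, by ring⟩]

theorem eMinus_mul_col (n : ℕ) (m : ℤ) :
    eMinus θ * col θ n (m - 1) = col θ (n + 1) (ℓ * m - 1) := by
  rw [col_succ, sub_eq_neg_add (_ * _), Int.add_mul_ediv_left _ _ length_pos.ne',
    neg_one_ediv_of_pos length_pos, eMinus_eq_digit,
    digit_congr θ (i := -1 + ℓ * m) (j := -1) ⟨m, by ring⟩, sub_eq_neg_add]

theorem Consecutive.ePlus_eMinus {n : ℕ} {k : ℤ} (hk : ¬ (ℓ : ℤ) ^ n ∣ k) :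
    Consecutive θ (eMinus θ * col θ n (k - 1)) (ePlus θ * col θ n k) := by
  rw [consecutive_iff]
  refine ⟨n + 1, by omega, ℓ * k, ?_, eMinus_mul_col .., ePlus_mul_col ..⟩
  rwa [pow_succ', mul_dvd_mul_iff_left length_pos.ne']

end Columns

section Structure

variable {A : Type*} {ℓ : ℕ} [NeZero ℓ]

/-- The standing assumptions: a primitive aperiodic simplified substitution of column rank at
least two. -/
structure IsAdmissible (θ : A → Fin ℓ → A) : Prop where
  prim : IsPrimitive θ
  aper : IsAperiodic θ
  simp : IsSimplified θ
  two_le : 2 ≤ columnRank θ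

theorem end_mul_apply (s t : Function.End A) (a : A) : (s * t) a = s (t a) := rfl

theorem end_pow_apply_eq_self {s : Function.End A} {a : A} (h : s a = a) (n : ℕ) :
    (s ^ n) a = a := by
  induction n with
  | zero => rfl
  | succ n ih => rw [pow_succ, end_mul_apply, h, ih]

theorem exists_pow_eq_self [Finite A] {s t : Function.End A} (hinj : Set.InjOn s (Set.range t))
    (hmaps : ∀ a, s (t a) ∈ Set.range t) : ∃ p, 1 ≤ p ∧ ∀ a, (s ^ p) (t a) = t a := by
  have hmem : ∀ n a, (s ^ n) (t a) ∈ Set.range t := by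
    intro n
    induction n with
    | zero => exact fun a => ⟨a, rfl⟩
    | succ n ih =>
      intro a
      obtain ⟨b, hb⟩ := ih a
      rw [pow_succ', end_mul_apply, ← hb]
      exact hmaps b
  have hpow : ∀ n, Set.InjOn (s ^ n) (Set.range t) := by
    intro n
    induction n with
    | zero => exact fun _ _ _ _ h => h
    | succ n ih =>
      rintro _ ⟨a, rfl⟩ _ ⟨b, rfl⟩ hab
      have hab : s ((s ^ n) (t a)) = s ((s ^ n) (t b)) := by
        rw [← end_mul_apply s, ← end_mul_apply s, ← pow_succ']
        exact hab
      exact ih ⟨a, rfl⟩ ⟨b, rfl⟩ (hinj (hmem n a) (hmem n b) hab)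
  have : Finite (Function.End A) := inferInstanceAs (Finite (A → A))
  obtain ⟨m, n, hmn, h⟩ := Finite.exists_ne_map_eq_of_infinite fun n : ℕ => s ^ n
  wlog hlt : m < n generalizing m n
  · exact this n m hmn.symm h.symm (by omega)
  obtain ⟨p, rfl⟩ := Nat.exists_eq_add_of_lt hlt
  refine ⟨p + 1, by omega, fun a => hpow m (hmem _ a) ⟨a, rfl⟩ ?_⟩
  change (s ^ m * s ^ (p + 1)) (t a) = (s ^ m) (t a)
  rw [← pow_add, ← add_assoc, ← h]

variable {θ : A → Fin ℓ → A}

theorem rank_digit (hs : IsSimplified θ) (i : ℤ) : rank (digit θ i) = columnRank θ := by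
  rw [← col_one, ← col_emod, pow_one]
  have h0 := Int.emod_nonneg i (length_pos (ℓ := ℓ)).ne'
  have h1 := Int.emod_lt_of_pos i (length_pos (ℓ := ℓ))
  lift i % (ℓ : ℤ) to ℕ using h0 with j
  have hj : j < ℓ := by exact_mod_cast h1
  rw [col_one, ← hs.rank_column ⟨j, hj⟩]
  congr 1
  funext a
  exact digit_natCast θ ⟨j, hj⟩ a

theorem rank_of_mem [Finite A] (hs : IsSimplified θ) {s : Function.End A}
    (h : s ∈ colSemigroup θ) : rank s = columnRank θ := by
  obtain ⟨n, hn, i, rfl⟩ := (mem_colSemigroup_iff θ).1 h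
  apply le_antisymm
  · obtain ⟨m, rfl⟩ := Nat.exists_eq_add_of_le' hn
    rw [← rank_digit hs i]
    refine Set.ncard_le_ncard ?_ (Set.toFinite _)
    rintro _ ⟨a, rfl⟩
    exact ⟨_, rfl⟩
  · have hpos := length_pow_pos (ℓ := ℓ) n
    have h0 := Int.emod_nonneg i hpos.ne'
    have h1 := Int.emod_lt_of_pos i hpos
    rw [← col_emod]
    lift i % (ℓ : ℤ) ^ n to ℕ using h0 with j
    have hj : j < ℓ ^ n := by exact_mod_cast h1
    exact Nat.sInf_le ⟨n, hn, ⟨j, hj⟩, by rw [column_eq_col]⟩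

theorem injOn_range [Finite A] (hs : IsSimplified θ) {s t : Function.End A}
    (h : s ∈ colSemigroup θ) (ht : t ∈ colSemigroup θ) : Set.InjOn s (Set.range t) := by
  refine Set.injOn_of_ncard_image_eq ?_ (Set.toFinite _)
  have h1 : s '' Set.range t = Set.range (s * t) := (Set.range_comp s t).symm
  rw [h1]
  exact (rank_of_mem hs (mul_mem h ht)).trans (rank_of_mem hs ht).symm

theorem digit_mem (θ : A → Fin ℓ → A) (i : ℤ) : digit θ i ∈ colSemigroup θ :=
  (mem_colSemigroup_iff θ).2 ⟨1, le_rfl, i, (col_one θ i).symm⟩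

theorem eq_of_col_eq [Finite A] (hs : IsSimplified θ) {n : ℕ} {i j : ℤ} {a b : A}
    (ha : a ∈ Set.range (digit θ j)) (hb : b ∈ Set.range (digit θ j))
    (h : col θ n i a = col θ n i b) : a = b := by
  rcases Nat.eq_zero_or_pos n with rfl | hn
  · exact h
  · exact injOn_range hs ((mem_colSemigroup_iff θ).2 ⟨n, hn, i, rfl⟩) (digit_mem θ j) ha hb h

namespace IsAdmissible

theorem nonempty (h : IsAdmissible θ) : Nonempty A := by
  by_contra hA
  rw [not_nonempty_iff] at hA
  have h1 := h.two_le
  rw [← rank_digit h.simp 0] at h1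
  simp [rank, Set.range_eq_empty] at h1

theorem two_le_length (h : IsAdmissible θ) : 2 ≤ ℓ := by
  by_contra hl
  have hl : ℓ = 1 := by have := Nat.pos_of_ne_zero (NeZero.ne ℓ); omega
  subst hl
  obtain ⟨k, hk⟩ := h.prim
  have hsub : Subsingleton A := by
    refine ⟨fun a b => ?_⟩
    obtain ⟨i, hi0, hi, hia⟩ := (mem_powWord θ).1 (hk a a)
    obtain ⟨j, hj0, hj, hjb⟩ := (mem_powWord θ).1 (hk a b)
    simp only [Nat.cast_one, one_pow] at hi hj
    obtain rfl : i = j := by omega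
    exact hia.symm.trans hjb
  have h1 := h.two_le
  rw [← rank_digit h.simp 0] at h1
  have := Set.ncard_le_one_of_subsingleton (Set.range fun a => digit θ 0 a)
  simp only [rank] at h1
  omega

theorem exists_pred (h : IsAdmissible θ) (a : A) : ∃ d, Allowed θ [d, a] := by
  obtain ⟨c⟩ := h.nonempty
  obtain ⟨k, hk⟩ := h.prim
  obtain ⟨i, hi0, hi, rfl⟩ := (mem_powWord θ).1 (hk (digit θ 1 c) a)
  have hpos := length_pow_pos (ℓ := ℓ) k
  have hl : (2 : ℤ) ≤ ℓ := by exact_mod_cast h.two_le_length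
  refine ⟨_, (allowed_pair_iff θ).2 ⟨c, 1 + k, (ℓ : ℤ) ^ k + i - 1, by omega, ?_, rfl, ?_⟩⟩
  · rw [pow_add, pow_one]
    nlinarith
  · rw [← col_one, col_col_apply, sub_add_cancel, Int.emod_eq_of_lt hi0 hi, one_mul]

theorem exists_succ (h : IsAdmissible θ) (a : A) : ∃ d, Allowed θ [a, d] := by
  obtain ⟨c⟩ := h.nonempty
  obtain ⟨k, hk⟩ := h.prim
  obtain ⟨i, hi0, hi, rfl⟩ := (mem_powWord θ).1 (hk (digit θ 0 c) a)
  have hpos := length_pow_pos (ℓ := ℓ) k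
  have hl : (2 : ℤ) ≤ ℓ := by exact_mod_cast h.two_le_length
  refine ⟨_, (allowed_pair_iff θ).2 ⟨c, 1 + k, i, hi0, ?_, ?_, rfl⟩⟩
  · rw [pow_add, pow_one]
    nlinarith
  · rw [← col_one, col_col_apply, Int.emod_eq_of_lt hi0 hi, zero_mul, zero_add]

end IsAdmissible

theorem Allowed.ends {a b : A} (h : Allowed θ [a, b]) :
    Allowed θ [eMinus θ a, ePlus θ b] := by
  obtain ⟨c, k, p, hp, hpk, rfl, rfl⟩ := (allowed_pair_iff θ).1 h
  have hl := length_pos (ℓ := ℓ)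
  refine (allowed_pair_iff θ).2 ⟨c, k + 1, ℓ * (p + 1) - 1, by nlinarith, ?_, ?_, ?_⟩
  · rw [pow_succ', sub_add_cancel]
    exact mul_lt_mul_of_pos_left hpk hl
  · rw [← eMinus_mul_col, add_sub_cancel_right, end_mul_apply]
  · rw [sub_add_cancel, ← ePlus_mul_col, end_mul_apply]

/-! ### Fixed points -/

omit [NeZero ℓ] in
theorem ediv_length_pow_of_nonneg {i : ℤ} {n : ℕ} (h0 : 0 ≤ i) (h : i < (ℓ : ℤ) ^ n) :
    i / (ℓ : ℤ) ^ n = 0 := Int.ediv_eq_zero_of_lt h0 h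

theorem ediv_length_pow_of_neg {i : ℤ} {n : ℕ} (h0 : i < 0) (h : -(ℓ : ℤ) ^ n ≤ i) :
    i / (ℓ : ℤ) ^ n = -1 := by
  have h1 := Int.add_mul_ediv_right i 1 (length_pow_pos (ℓ := ℓ) n).ne'
  rw [Int.ediv_eq_zero_of_lt (by omega) (by omega)] at h1
  omega

omit [NeZero ℓ] in
theorem natAbs_lt_length_pow (hl : 2 ≤ ℓ) {i : ℤ} {n : ℕ} (h : i.natAbs ≤ n) :
    -(ℓ : ℤ) ^ n < i ∧ i < (ℓ : ℤ) ^ n := by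
  have h1 : n < ℓ ^ n := Nat.lt_pow_self (by omega)
  have h2 : (n : ℤ) < (ℓ : ℤ) ^ n := by exact_mod_cast h1
  omega

theorem IsFixed.apply {x : ℤ → A} (hx : substSeq θ x = x) (n : ℕ) (i : ℤ) :
    x i = col θ n i (x (i / (ℓ : ℤ) ^ n)) := by
  rw [← iterate_substSeq, Function.iterate_fixed hx]

theorem IsFixed.ext (hl : 2 ≤ ℓ) {x y : ℤ → A} (hx : substSeq θ x = x) (hy : substSeq θ y = y)
    (h1 : x (-1) = y (-1)) (h0 : x 0 = y 0) : x = y := by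
  funext i
  obtain ⟨hi1, hi2⟩ := natAbs_lt_length_pow hl (le_refl i.natAbs)
  rw [IsFixed.apply hx i.natAbs i, IsFixed.apply hy i.natAbs i]
  rcases lt_or_ge i 0 with h | h
  · rw [ediv_length_pow_of_neg h hi1.le, h1]
  · rw [ediv_length_pow_of_nonneg h hi2, h0]

theorem exists_periodic (hl : 2 ≤ ℓ) {p : ℕ} (hp : 1 ≤ p) {a b : A} (ha : (eMinus θ ^ p) a = a)
    (hb : (ePlus θ ^ p) b = b) (hab : Allowed θ [a, b]) :
    ∃ x ∈ shiftSpace θ, (substSeq θ)^[p] x = x ∧ x (-1) = a ∧ x 0 = b := by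
  let s : ℤ → A := fun i => if i < 0 then a else b
  have hs : ∀ k (i : ℤ), i = 0 ∨ i = -1 → col θ (p * k) i (s i) = s i := by
    rintro k i (rfl | rfl)
    · rw [col_zero_right, pow_mul]
      exact end_pow_apply_eq_self hb k
    · rw [col_neg_one, pow_mul]
      exact end_pow_apply_eq_self ha k
  have hdiv : ∀ (m : ℕ) (i : ℤ), -(ℓ : ℤ) ^ m ≤ i → i < (ℓ : ℤ) ^ m →
      (i / (ℓ : ℤ) ^ m = 0 ∨ i / (ℓ : ℤ) ^ m = -1) ∧ s (i / (ℓ : ℤ) ^ m) = s i := by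
    intro m i h1 h2
    rcases lt_or_ge i 0 with h | h
    · rw [ediv_length_pow_of_neg h h1]
      simp [s, h]
    · rw [ediv_length_pow_of_nonneg h h2]
      simp [s, h]
  have hstab : ∀ (m k : ℕ) (i : ℤ), -(ℓ : ℤ) ^ (p * m) ≤ i → i < (ℓ : ℤ) ^ (p * m) →
      col θ (p * (m + k)) i (s i) = col θ (p * m) i (s i) := by
    intro m k i h1 h2
    obtain ⟨h3, h4⟩ := hdiv _ i h1 h2
    rw [mul_add, add_comm, col_add, end_mul_apply]
    conv_lhs => rw [← h4, hs k _ h3, h4]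
  have hbound : ∀ (i : ℤ) (m : ℕ), i.natAbs ≤ m →
      -(ℓ : ℤ) ^ (p * m) < i ∧ i < (ℓ : ℤ) ^ (p * m) := fun i m h =>
    natAbs_lt_length_pow hl (h.trans (Nat.le_mul_of_pos_left m hp))
  let x : ℤ → A := fun i => col θ (p * i.natAbs) i (s i)
  have hx : ∀ (m : ℕ) (i : ℤ), -(ℓ : ℤ) ^ (p * m) ≤ i → i < (ℓ : ℤ) ^ (p * m) →
      x i = col θ (p * m) i (s i) := by
    intro m i h1 h2
    obtain ⟨h3, h4⟩ := hbound i _ le_rfl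
    rw [← hstab m i.natAbs i h1 h2, add_comm, hstab _ _ i h3.le h4]
  refine ⟨x, (mem_shiftSpace_iff θ).2 fun i n => ?_, ?_, ?_, ?_⟩
  · obtain ⟨c, k, q, hq, hqk, rfl, rfl⟩ := (allowed_pair_iff θ).1 hab
    obtain ⟨h1, h2⟩ := hbound i (i.natAbs + n) (by omega)
    obtain ⟨h3, h4⟩ := hbound (i + n) (i.natAbs + n) (by omega)
    set m := i.natAbs + n
    set P := (ℓ : ℤ) ^ (p * m) with hP
    have hPpos : 0 < P := length_pow_pos _
    refine ⟨c, k + p * m, (q + 1) * P + i, ?_, ?_, fun j hj hjn => ?_⟩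
    · nlinarith
    · rw [pow_add, ← hP]
      nlinarith
    · rw [hx m (i + j) (by omega) (by omega), col_add, end_mul_apply, ← hP,
        col_congr θ (i := (q + 1) * P + i + j) (j := i + j) ⟨q + 1, by rw [← hP]; ring⟩,
        add_assoc, add_comm ((q + 1) * P), Int.add_mul_ediv_right _ _ hPpos.ne']
      congr 1
      rcases lt_or_ge (i + j) 0 with h | h
      · rw [ediv_length_pow_of_neg h (by omega), neg_add_cancel_comm_assoc]
        simp [s, h]
      · rw [ediv_length_pow_of_nonneg h (by omega), zero_add]
        simp [s, h]
  · funext i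
    obtain ⟨h1, h2⟩ := hbound (i / (ℓ : ℤ) ^ p) _ le_rfl
    obtain ⟨h3, h4⟩ := hbound i (i.natAbs) le_rfl
    rw [iterate_substSeq, hx _ _ h1.le h2]
    have h5 : s (i / (ℓ : ℤ) ^ p) = s i := by
      have : i / (ℓ : ℤ) ^ p < 0 ↔ i < 0 :=
        ⟨fun h => by
          by_contra h'
          exact absurd (Int.ediv_nonneg (not_lt.1 h') (length_pow_pos (ℓ := ℓ) p).le) (not_le.2 h),
        fun h => Int.ediv_neg_of_neg_of_pos h (length_pow_pos p)⟩
      simp [s, this]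
    rw [h5, col_add_apply]
    set m := (i / (ℓ : ℤ) ^ p).natAbs
    have h6 : p * m + p = p * (m + 1) := by ring
    have h7 := Int.ediv_mul_le i (length_pow_pos (ℓ := ℓ) p).ne'
    have h8 := Int.lt_ediv_add_one_mul_self i (length_pow_pos (ℓ := ℓ) p)
    have h9 := length_pow_pos (ℓ := ℓ) p
    have h10 : (ℓ : ℤ) ^ (p * (m + 1)) = (ℓ : ℤ) ^ (p * m) * (ℓ : ℤ) ^ p := by
      rw [← pow_add, h6]
    rw [h6, ← hx (m + 1) i (by rw [h10]; nlinarith) (by rw [h10]; nlinarith)]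
  · rw [hx 0 (-1) (by simp) (by simp)]
    simp [s, Function.End.one_def]
  · rw [hx 0 0 (by simp) (by simp)]
    simp [s, Function.End.one_def]

namespace IsAdmissible

variable [Finite A]

theorem ends_fix (h : IsAdmissible θ) {a b : A} (hab : Allowed θ [a, b]) :
    eMinus θ (eMinus θ a) = eMinus θ a ∧ ePlus θ (ePlus θ b) = ePlus θ b := by
  obtain ⟨p, hp, hp'⟩ := exists_pow_eq_self
    (injOn_range h.simp (eMinus_mem θ) (eMinus_mem θ)) fun a => ⟨_, rfl⟩
  obtain ⟨q, hq, hq'⟩ := exists_pow_eq_self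
    (injOn_range h.simp (ePlus_mem θ) (ePlus_mem θ)) fun a => ⟨_, rfl⟩
  have h1 : (eMinus θ ^ (p * q)) (eMinus θ a) = eMinus θ a := by
    rw [pow_mul]
    exact end_pow_apply_eq_self (hp' a) q
  have h2 : (ePlus θ ^ (p * q)) (ePlus θ b) = ePlus θ b := by
    rw [mul_comm, pow_mul]
    exact end_pow_apply_eq_self (hq' b) p
  obtain ⟨x, hx, hper, hx1, hx0⟩ := exists_periodic h.two_le_length
    (Nat.mul_pos hp hq) h1 h2 hab.ends
  have hfix := h.simp.fixed_of_periodic x hx _ (Nat.mul_pos hp hq) hper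
  constructor
  · rw [← hx1]
    conv_rhs => rw [← hfix]
    rw [eMinus_eq_digit, substSeq_apply, neg_one_ediv_of_pos length_pos]
  · rw [← hx0]
    conv_rhs => rw [← hfix]
    rw [ePlus_eq_digit, substSeq_apply, Int.zero_ediv]

theorem ePlus_mul_self (h : IsAdmissible θ) : ePlus θ * ePlus θ = ePlus θ := by
  funext b
  obtain ⟨a, hab⟩ := h.exists_pred b
  exact (h.ends_fix hab).2

theorem eMinus_mul_self (h : IsAdmissible θ) : eMinus θ * eMinus θ = eMinus θ := by
  funext a
  obtain ⟨b, hab⟩ := h.exists_succ a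
  exact (h.ends_fix hab).1

theorem mem_twoLetter (h : IsAdmissible θ) {a b : A} :
    (a, b) ∈ twoLetter θ ↔ eMinus θ a = a ∧ ePlus θ b = b ∧ Allowed θ [a, b] := by
  constructor
  · rintro ⟨⟨c, hc⟩, ⟨d, hd⟩, hab⟩
    refine ⟨?_, ?_, hab⟩
    · change eMinus θ c = a at hc
      rw [← hc]
      exact congrFun h.eMinus_mul_self c
    · change ePlus θ d = b at hd
      rw [← hd]
      exact congrFun h.ePlus_mul_self d
  · rintro ⟨ha, hb, hab⟩
    exact ⟨⟨a, ha⟩, ⟨b, hb⟩, hab⟩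

omit [Finite A] in
theorem exists_twoLetter_right (h : IsAdmissible θ) {b : A} (hb : ePlus θ b = b) :
    ∃ a, (a, b) ∈ twoLetter θ := by
  obtain ⟨d, hd⟩ := h.exists_pred b
  refine ⟨eMinus θ d, ⟨d, rfl⟩, ⟨b, hb⟩, ?_⟩
  have := hd.ends
  rwa [hb] at this

omit [Finite A] in
theorem exists_twoLetter_left (h : IsAdmissible θ) {a : A} (ha : eMinus θ a = a) :
    ∃ b, (a, b) ∈ twoLetter θ := by
  obtain ⟨d, hd⟩ := h.exists_succ a
  refine ⟨ePlus θ d, ⟨a, ha⟩, ⟨d, rfl⟩, ?_⟩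
  have := hd.ends
  rwa [ha] at this

theorem exists_fixed (h : IsAdmissible θ) {a b : A} (hab : (a, b) ∈ twoLetter θ) :
    ∃ x ∈ shiftSpace θ, substSeq θ x = x ∧ x (-1) = a ∧ x 0 = b := by
  obtain ⟨ha, hb, hab⟩ := h.mem_twoLetter.1 hab
  exact exists_periodic h.two_le_length le_rfl (by rwa [pow_one]) (by rwa [pow_one]) hab

omit [NeZero ℓ] [Finite A] in
theorem allowed_pair_of_mem {x : ℤ → A} (hx : x ∈ shiftSpace θ) (i : ℤ) :
    Allowed θ [x (i - 1), x i] := by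
  have h := hx (i - 1) 2
  simpa [List.ofFn_succ] using h

theorem mem_twoLetter_of_fixed (h : IsAdmissible θ) {x : ℤ → A} (hx : x ∈ shiftSpace θ)
    (hfix : substSeq θ x = x) : (x (-1), x 0) ∈ twoLetter θ := by
  refine h.mem_twoLetter.2 ⟨?_, ?_, allowed_pair_of_mem hx 0⟩
  · conv_rhs => rw [← hfix]
    rw [eMinus_eq_digit, substSeq_apply, neg_one_ediv_of_pos length_pos]
  · conv_rhs => rw [← hfix]
    rw [ePlus_eq_digit, substSeq_apply, Int.zero_ediv]

theorem bijOn_fixed (h : IsAdmissible θ) :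
    Set.BijOn (fun x : ℤ → A => (x (-1), x 0))
      {x | x ∈ shiftSpace θ ∧ substSeq θ x = x} (twoLetter θ) := by
  refine ⟨fun x hx => h.mem_twoLetter_of_fixed hx.1 hx.2, fun x hx y hy hxy => ?_, ?_⟩
  · simp only [Prod.mk.injEq] at hxy
    exact IsFixed.ext h.two_le_length hx.2 hy.2 hxy.1 hxy.2
  · rintro ⟨a, b⟩ hab
    obtain ⟨x, hx, hfix, rfl, rfl⟩ := h.exists_fixed hab
    exact ⟨x, ⟨hx, hfix⟩, rfl⟩

end IsAdmissible

/-! ### The corners `e S f` -/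

omit [NeZero ℓ] in
theorem mem_corner_iff {e f s : Function.End A} (he : e ∈ colSemigroup θ)
    (hee : e * e = e) (hf : f ∈ colSemigroup θ) (hff : f * f = f) :
    s ∈ corner θ e f ↔ s ∈ colSemigroup θ ∧ e * s = s ∧ s * f = s := by
  constructor
  · rintro ⟨t, ht, rfl⟩
    refine ⟨mul_mem (mul_mem he ht) hf, ?_, ?_⟩
    · rw [← mul_assoc, ← mul_assoc, hee]
    · rw [mul_assoc, hff]
  · rintro ⟨hs, h1, h2⟩
    exact ⟨s, hs, by rw [h1, h2]⟩

theorem exists_inverse_of_mem_corner_self [Finite A] (hs : IsSimplified θ) {e g : Function.End A}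
    (he : e ∈ colSemigroup θ) (hee : e * e = e) (hg : g ∈ corner θ e e) :
    ∃ q ∈ corner θ e e, g * q = e ∧ q * g = e := by
  obtain ⟨hgS, h1, h2⟩ := (mem_corner_iff he hee he hee).1 hg
  obtain ⟨p, hp, hpe⟩ := exists_pow_eq_self (injOn_range hs hgS he)
    fun a => ⟨g (e a), congrFun h1 (e a)⟩
  obtain ⟨p, rfl⟩ := Nat.exists_eq_add_of_le' hp
  have hpe : g ^ (p + 1) * e = e := funext hpe
  have hcomm : ∀ k, g ^ k * e = e * g ^ k := fun k => (Commute.pow_left (h2.trans h1.symm) k)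
  have hmem : ∀ k, e * g ^ k ∈ colSemigroup θ := by
    intro k
    induction k with
    | zero => simpa using he
    | succ k ih =>
      rw [pow_succ, ← mul_assoc]
      exact mul_mem ih hgS
  refine ⟨e * g ^ p, (mem_corner_iff he hee he hee).2 ⟨hmem p, ?_, ?_⟩, ?_, ?_⟩
  · rw [← mul_assoc, hee]
  · rw [mul_assoc, hcomm, ← mul_assoc, hee]
  · rw [← mul_assoc, h2, ← pow_succ']
    conv_rhs => rw [← hpe, pow_succ, mul_assoc, h2, ← pow_succ]
  · rw [mul_assoc, ← pow_succ, ← hcomm, hpe]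

theorem exists_inverse_of_mem_corner [Finite A] (hs : IsSimplified θ) {e f r : Function.End A}
    (he : e ∈ colSemigroup θ) (hee : e * e = e) (hf : f ∈ colSemigroup θ) (hff : f * f = f)
    (hr : r ∈ corner θ e f) : ∃ q ∈ corner θ f e, r * q = e ∧ q * r = f := by
  obtain ⟨hrS, h1, h2⟩ := (mem_corner_iff he hee hf hff).1 hr
  have hre : r * e ∈ corner θ e e := (mem_corner_iff he hee he hee).2
    ⟨mul_mem hrS he, by rw [← mul_assoc, h1], by rw [mul_assoc, hee]⟩
  obtain ⟨q, hq, hrq, -⟩ := exists_inverse_of_mem_corner_self hs he hee hre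
  obtain ⟨hqS, hq1, hq2⟩ := (mem_corner_iff he hee he hee).1 hq
  have hrfq : r * (f * q) = e := by rw [← mul_assoc, h2, ← hrq, mul_assoc, hq1]
  refine ⟨f * q, (mem_corner_iff hf hff he hee).2 ⟨mul_mem hf hqS, by rw [← mul_assoc, hff],
    by rw [mul_assoc, hq2]⟩, hrfq, ?_⟩
  funext a
  refine injOn_range hs hrS hf ⟨q (r a), rfl⟩ ⟨a, rfl⟩ ?_
  change (r * (f * q) * r) a = (r * f) a
  rw [hrfq, h1, h2]

end Structure

section Recognizability

variable {A : Type*} {ℓ : ℕ} [NeZero ℓ] {θ : A → Fin ℓ → A}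

theorem mem_shiftSpace_of_windows {x z : ℤ → A} (hx : x ∈ shiftSpace θ)
    (h : ∀ (i : ℤ) (n : ℕ), ∃ t : ℤ, ∀ j : ℤ, 0 ≤ j → j < n → z (i + j) = x (t + j)) :
    z ∈ shiftSpace θ := by
  rw [mem_shiftSpace_iff] at hx ⊢
  intro i n
  obtain ⟨t, ht⟩ := h i n
  obtain ⟨a, k, p, hp, hpn, hw⟩ := hx t n
  exact ⟨a, k, p, hp, hpn, fun j hj hjn => (ht j hj hjn).trans (hw j hj hjn)⟩

theorem IsAperiodic.not_periodic (h : IsAperiodic θ) {x z : ℤ → A} (hx : x ∈ shiftSpace θ)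
    {p : ℤ} (hp : p ≠ 0) (hz : ∀ i, z (i + p) = z i)
    (hw : ∀ (i : ℤ) (n : ℕ), ∃ t : ℤ, ∀ j : ℤ, 0 ≤ j → j < n → z (i + j) = x (t + j)) : False :=
  h ⟨z, mem_shiftSpace_of_windows hx hw⟩ p hp (Subtype.ext (funext hz))

theorem IsAperiodic.not_eventually_periodic_right (h : IsAperiodic θ) {x : ℤ → A}
    (hx : x ∈ shiftSpace θ) {p N : ℤ} (hp : 0 < p) (hper : ∀ i, N ≤ i → x (i + p) = x i) :
    False := by
  have hmul : ∀ (k : ℕ) (i : ℤ), N ≤ i → x (i + k * p) = x i := by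
    intro k i hi
    induction k with
    | zero => simp
    | succ k ih =>
      have : (0 : ℤ) ≤ k * p := by positivity
      rw [← ih, ← hper (i + k * p) (by omega)]
      congr 1
      push_cast
      ring
  have hz : ∀ i, x (i + ((N - i).toNat : ℕ) * p) = x (N + (i - N) % p) := by
    intro i
    have h0 := Int.emod_nonneg (i - N) hp.ne'
    have h1 := Int.emod_add_mul_ediv (i - N) p
    have h2 : (0 : ℤ) ≤ (i - N) / p + (N - i).toNat := by
      rcases le_total N i with hi | hi
      · have := Int.ediv_nonneg (sub_nonneg.2 hi) hp.le
        omega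
      · rw [Int.toNat_of_nonneg (by omega)]
        have := (Int.le_ediv_iff_mul_le hp (a := i - N) (b := i - N)).2 (by nlinarith)
        omega
    rw [← hmul _ (N + (i - N) % p) (by omega)]
    swap
    · exact ((i - N) / p + (N - i).toNat).toNat
    rw [Int.toNat_of_nonneg h2]
    congr 1
    linear_combination -h1
  refine h.not_periodic hx (z := fun i => x (N + (i - N) % p)) hp.ne' (fun i => ?_) fun i n => ?_
  · rw [add_sub_right_comm, Int.add_emod_right]
  · refine ⟨i + ((N - i).toNat : ℕ) * p, fun j hj _ => ?_⟩
    have h1 : (N - i).toNat = (N - (i + j)).toNat + ((N - i).toNat - (N - (i + j)).toNat) := by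
      omega
    have h2 : N ≤ i + j + ((N - (i + j)).toNat : ℕ) * p := by
      have : (0 : ℤ) ≤ ((N - (i + j)).toNat : ℕ) := by positivity
      have : N - (i + j) ≤ ((N - (i + j)).toNat : ℕ) := Int.self_le_toNat _
      nlinarith
    rw [← hz, ← hmul ((N - i).toNat - (N - (i + j)).toNat) _ h2]
    congr 1
    rw [h1]
    push_cast [Nat.add_sub_cancel_left]
    ring

theorem IsAperiodic.not_eventually_periodic_left (h : IsAperiodic θ) {x : ℤ → A}
    (hx : x ∈ shiftSpace θ) {p N : ℤ} (hp : 0 < p) (hper : ∀ i, i ≤ N → x (i - p) = x i) :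
    False := by
  have hmul : ∀ (k : ℕ) (i : ℤ), i ≤ N → x (i - k * p) = x i := by
    intro k i hi
    induction k with
    | zero => simp
    | succ k ih =>
      have : (0 : ℤ) ≤ k * p := by positivity
      rw [← ih, ← hper (i - k * p) (by omega)]
      congr 1
      push_cast
      ring
  have hz : ∀ (i : ℤ) (k : ℕ), i - k * p ≤ N → x (i - k * p) = x (N - (N - i) % p) := by
    intro i k hk
    have h0 := Int.emod_nonneg (N - i) hp.ne'
    have h1 := Int.emod_add_mul_ediv (N - i) p
    have h2 : 0 ≤ (N - i) / p + k := by
      rw [← Int.add_mul_ediv_right _ _ hp.ne']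
      exact Int.ediv_nonneg (by omega) hp.le
    rw [← hmul _ (N - (N - i) % p) (by omega)]
    swap
    · exact ((N - i) / p + k).toNat
    rw [Int.toNat_of_nonneg h2]
    congr 1
    linear_combination h1
  refine h.not_periodic hx (z := fun i => x (N - (N - i) % p)) hp.ne' (fun i => ?_) fun i n => ?_
  · rw [← sub_sub, ← Int.sub_emod_right (N - i) p]
  · refine ⟨i - ((i + n - N).toNat : ℕ) * p, fun j hj hjn => ?_⟩
    have h2 : i + j - ((i + n - N).toNat : ℕ) * p ≤ N := by
      have : (0 : ℤ) ≤ ((i + n - N).toNat : ℕ) := by positivity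
      have : i + n - N ≤ ((i + n - N).toNat : ℕ) := Int.self_le_toNat _
      nlinarith
    rw [← hz _ _ h2]
    congr 1
    ring

theorem range_digit_congr {i j : ℤ} (h : (ℓ : ℤ) ∣ i - j) :
    Set.range (digit θ i) = Set.range (digit θ j) := by rw [digit_congr θ h]

theorem exists_lt_apply_mul_eq [Finite A] (x : ℤ → A) (q : ℤ) :
    ∃ m n : ℕ, m < n ∧ x (q * m) = x (q * n) := by
  obtain ⟨m, n, hmn, h⟩ := Finite.exists_ne_map_eq_of_infinite fun n : ℕ => x (q * n)
  rcases lt_or_gt_of_ne hmn with hlt | hlt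
  · exact ⟨m, n, hlt, h⟩
  · exact ⟨n, m, hlt, h.symm⟩

/-- Recognizability: two decompositions of a sequence into the words `θ ^ n (a)` have the same
cutting points. -/
theorem IsAdmissible.dvd_of_iterate_eq [Finite A] (h : IsAdmissible θ) {n : ℕ} {x y y' : ℤ → A}
    {k k' r : ℤ} (hx : x ∈ shiftSpace θ)
    (hy : ∀ j, y j ∈ Set.range (digit θ (j + k))) (hy' : ∀ j, y' j ∈ Set.range (digit θ (j + k')))
    (hxy : ∀ i, x i = col θ n i (y (i / (ℓ : ℤ) ^ n)))
    (hxy' : ∀ i, x i = col θ n (i + r) (y' ((i + r) / (ℓ : ℤ) ^ n))) : (ℓ : ℤ) ^ n ∣ r := by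
  by_contra hr
  set P := (ℓ : ℤ) ^ n with hP
  have hPpos : 0 < P := length_pow_pos n
  have hr0 := Int.emod_nonneg r hPpos.ne'
  have hr1 := Int.emod_lt_of_pos r hPpos
  have hr2 : r % P ≠ 0 := fun h => hr (Int.dvd_of_emod_eq_zero h)
  have hr3 := Int.emod_add_mul_ediv r P
  have hblock : ∀ u j, 0 ≤ j → j < P → x (P * u + j) = col θ n j (y u) := by
    intro u j hj hjP
    rw [hxy, add_comm, Int.add_mul_ediv_left _ _ hPpos.ne', Int.ediv_eq_zero_of_lt hj hjP, zero_add]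
    exact congrFun (col_congr θ ⟨u, by rw [← hP]; ring⟩) _
  have hblock' : ∀ u j, 0 ≤ j → j < P →
      x (P * u + (P - r % P) + j) = col θ n j (y' (u + r / P + 1)) := by
    intro u j hj hjP
    have he : P * u + (P - r % P) + j + r = j + P * (u + r / P + 1) := by linear_combination -hr3
    rw [hxy', he, Int.add_mul_ediv_left _ _ hPpos.ne', Int.ediv_eq_zero_of_lt hj hjP, zero_add]
    exact congrFun (col_congr θ ⟨u + r / P + 1, by rw [← hP]; ring⟩) _
  have hdet : ∀ u u', (ℓ : ℤ) ∣ u - u' → x (P * u) = x (P * u') →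
      (∀ j, 0 ≤ j → j < P → x (P * u + j) = x (P * u' + j)) ∧
        x (P * (u + 1)) = x (P * (u' + 1)) := by
    intro u u' huu hu
    have h1 : y u = y u' := by
      have h2 := hblock u 0 le_rfl hPpos
      have h3 := hblock u' 0 le_rfl hPpos
      rw [add_zero] at h2 h3
      refine eq_of_col_eq h.simp (hy u) ?_ (h2.symm.trans (hu.trans h3))
      rw [range_digit_congr (i := u + k) (j := u' + k) (by rwa [add_sub_add_right_eq_sub])]
      exact hy u'
    have h2 : ∀ j, 0 ≤ j → j < P → x (P * u + j) = x (P * u' + j) := by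
      intro j hj hjP
      rw [hblock u j hj hjP, hblock u' j hj hjP, h1]
    refine ⟨h2, ?_⟩
    have h3 : y' (u + r / P + 1) = y' (u' + r / P + 1) := by
      have h4 := hblock' u 0 le_rfl hPpos
      have h5 := hblock' u' 0 le_rfl hPpos
      rw [add_zero] at h4 h5
      refine eq_of_col_eq h.simp (hy' _) ?_
        (h4.symm.trans ((h2 (P - r % P) (by omega) (by omega)).trans h5))
      rw [range_digit_congr (i := u + r / P + 1 + k') (j := u' + r / P + 1 + k')
        (by convert huu using 1; ring)]
      exact hy' _
    have h4 := hblock' u (r % P) hr0 hr1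
    have h5 := hblock' u' (r % P) hr0 hr1
    rw [h3, ← h5] at h4
    convert h4 using 2 <;> ring
  obtain ⟨m, m', hmm, hm⟩ := exists_lt_apply_mul_eq x (P * ℓ)
  have hind : ∀ t : ℕ, x (P * (ℓ * m + t)) = x (P * (ℓ * m' + t)) := by
    intro t
    induction t with
    | zero => simpa [mul_assoc] using hm
    | succ t ih =>
      have := (hdet _ _ ⟨m - m', by ring⟩ ih).2
      push_cast
      rwa [← add_assoc, ← add_assoc]
  have hmm' : (0 : ℤ) < m' - m := by omega
  refine h.aper.not_eventually_periodic_right hx (p := P * ℓ * (m' - m)) (N := P * (ℓ * m))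
    (mul_pos (mul_pos hPpos length_pos) hmm') fun i hi => ?_
  have h1 := Int.emod_add_mul_ediv (i - P * (ℓ * m)) P
  have h2 := Int.ediv_nonneg (sub_nonneg.2 hi) hPpos.le
  have h3 := Int.emod_nonneg (i - P * (ℓ * m)) hPpos.ne'
  have h4 := Int.emod_lt_of_pos (i - P * (ℓ * m)) hPpos
  have h5 := (hdet _ _ ⟨m - m', by ring⟩ (hind ((i - P * (ℓ * m)) / P).toNat)).1 _ h3 h4
  rw [Int.toNat_of_nonneg h2] at h5
  convert h5.symm using 2
  · linear_combination -h1
  · linear_combination -h1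

/-- Some letter of `im e₊` has two predecessors in `im e₋`. -/
theorem IsAdmissible.exists_two_pred [Finite A] (h : IsAdmissible θ) :
    ∃ a a' b, a ≠ a' ∧ (a, b) ∈ twoLetter θ ∧ (a', b) ∈ twoLetter θ := by
  by_contra! hcon
  obtain ⟨c⟩ := h.nonempty
  obtain ⟨a, hab⟩ := h.exists_twoLetter_right (congrFun h.ePlus_mul_self c)
  obtain ⟨y, hy, hfix, -, -⟩ := h.exists_fixed hab
  have hr : ∀ j, y j ∈ Set.range (digit θ j) := fun j => by
    rw [← hfix]
    exact ⟨_, rfl⟩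
  have htl : ∀ j, (eMinus θ (y (j - 1)), ePlus θ (y j)) ∈ twoLetter θ := fun j =>
    ⟨⟨_, rfl⟩, ⟨_, rfl⟩, (IsAdmissible.allowed_pair_of_mem hy j).ends⟩
  have hdet : ∀ j j', (ℓ : ℤ) ∣ j - j' → y j = y j' → y (j - 1) = y (j' - 1) := by
    intro j j' hjj hj
    have h1 := htl j
    rw [hj] at h1
    have h2 : eMinus θ (y (j - 1)) = eMinus θ (y (j' - 1)) := by
      by_contra hne
      exact hcon _ _ _ hne h1 (htl j')
    refine injOn_range h.simp (eMinus_mem θ) (digit_mem θ (j - 1)) (hr _) ?_ h2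
    rw [range_digit_congr (i := j - 1) (j := j' - 1) (by rwa [sub_sub_sub_cancel_right])]
    exact hr _
  obtain ⟨m, m', hmm, hm⟩ := exists_lt_apply_mul_eq y ℓ
  have hind : ∀ t : ℕ, y (ℓ * m - t) = y (ℓ * m' - t) := by
    intro t
    induction t with
    | zero => simpa using hm
    | succ t ih =>
      have := hdet _ _ ⟨m - m', by ring⟩ ih
      push_cast
      rwa [← sub_sub, ← sub_sub]
  have hmm' : (0 : ℤ) < m' - m := by omega
  refine h.aper.not_eventually_periodic_left hy (p := ℓ * (m' - m)) (N := ℓ * m')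
    (mul_pos length_pos hmm') fun i hi => ?_
  have h1 := hind (ℓ * m' - i).toNat
  rw [Int.toNat_of_nonneg (by omega)] at h1
  convert h1 using 2 <;> ring

/-! ### Desubstitution -/

theorem substSeq_mem {x : ℤ → A} (hx : x ∈ shiftSpace θ) : substSeq θ x ∈ shiftSpace θ := by
  rw [mem_shiftSpace_iff] at hx ⊢
  intro i n
  have hl := length_pos (ℓ := ℓ)
  obtain ⟨a, k, p, hp, hpn, hw⟩ := hx (i / ℓ) (n + 1)
  have h0 := Int.emod_nonneg i hl.ne'
  have h1 := Int.emod_lt_of_pos i hl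
  have h2 := Int.emod_add_mul_ediv i ℓ
  refine ⟨a, k + 1, ℓ * p + i % ℓ, by positivity, ?_, fun j hj hjn => ?_⟩
  · push_cast at hpn
    rw [pow_succ']
    nlinarith
  · have h3 : (i + j) / ℓ = i / ℓ + (i % ℓ + j) / ℓ := by
      have h5 : i + j = i % ℓ + j + ℓ * (i / ℓ) := by linear_combination -h2
      rw [h5, Int.add_mul_ediv_left _ _ hl.ne', add_comm]
    have h4 : (ℓ * p + i % ℓ + j) / ℓ = p + (i % ℓ + j) / ℓ := by
      rw [add_assoc, add_comm (ℓ * p), Int.add_mul_ediv_left _ _ hl.ne', add_comm]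
    rw [substSeq_apply, h3, hw _ (Int.ediv_nonneg (by omega) hl.le), col_succ, h4,
      digit_congr θ (i := i + j) (j := ℓ * p + i % ℓ + j) ⟨i / ℓ - p, by linear_combination -h2⟩]
    · rfl
    · refine Int.ediv_lt_of_lt_mul hl ?_
      push_cast
      nlinarith

/-- The action of `θ` on the shift space. -/
def substMap (θ : A → Fin ℓ → A) (x : shiftSpace θ) : shiftSpace θ :=
  ⟨substSeq θ x.1, substSeq_mem x.2⟩

theorem substMap_iterate_val (n : ℕ) (x : shiftSpace θ) :
    ((substMap θ)^[n] x).1 = (substSeq θ)^[n] x.1 := by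
  induction n generalizing x with
  | zero => rfl
  | succ n ih => rw [Function.iterate_succ_apply, ih, Function.iterate_succ_apply]; rfl

/-- `x` is the image under `σ ^ k ∘ θ ^ n` of a point of the shift space. -/
def IsLevel (θ : A → Fin ℓ → A) (n : ℕ) (k : ℤ) (x : shiftSpace θ) : Prop :=
  ∃ y : shiftSpace θ, shift θ k ((substMap θ)^[n] y) = x

theorem IsLevel.exists_apply {n : ℕ} {k : ℤ} {x : shiftSpace θ} (h : IsLevel θ n k x) :
    ∃ y : shiftSpace θ, ∀ i, x.1 i = col θ n (i + k) (y.1 ((i + k) / (ℓ : ℤ) ^ n)) := by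
  obtain ⟨y, rfl⟩ := h
  refine ⟨y, fun i => ?_⟩
  rw [← iterate_substSeq, ← substMap_iterate_val]
  rfl

theorem isLevel_of_apply {n : ℕ} {k : ℤ} {x y : shiftSpace θ}
    (h : ∀ i, x.1 i = col θ n (i + k) (y.1 ((i + k) / (ℓ : ℤ) ^ n))) : IsLevel θ n k x := by
  refine ⟨y, Subtype.ext (funext fun i => ?_)⟩
  rw [h, ← iterate_substSeq, ← substMap_iterate_val]
  rfl

theorem IsLevel.congr {n : ℕ} {k k' : ℤ} {x : shiftSpace θ} (h : IsLevel θ n k x)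
    (hk : (ℓ : ℤ) ^ n ∣ k - k') : IsLevel θ n k' x := by
  obtain ⟨y, hy⟩ := h.exists_apply
  obtain ⟨q, hq⟩ := hk
  refine isLevel_of_apply (y := shift θ q y) fun i => ?_
  have h1 : i + k = i + k' + (ℓ : ℤ) ^ n * q := by linear_combination hq
  rw [hy, h1, Int.add_mul_ediv_left _ _ (length_pow_pos n).ne',
    col_congr θ (i := i + k' + (ℓ : ℤ) ^ n * q) (j := i + k') ⟨q, by ring⟩]
  rfl

theorem IsLevel.shift {n : ℕ} {k : ℤ} {x : shiftSpace θ} (h : IsLevel θ n k x) (t : ℤ) :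
    IsLevel θ n (k + t) (shift θ t x) := by
  obtain ⟨y, rfl⟩ := h
  exact ⟨y, by rw [add_comm, ← shift_comp]; rfl⟩

theorem IsLevel.of_succ {n : ℕ} {k : ℤ} {x : shiftSpace θ} (h : IsLevel θ (n + 1) k x) :
    IsLevel θ n k x := by
  obtain ⟨y, rfl⟩ := h
  exact ⟨substMap θ y, rfl⟩

section Topology

variable [TopologicalSpace A] [DiscreteTopology A]

theorem continuous_substMap : Continuous (substMap θ) := by
  refine Continuous.subtype_mk (continuous_pi fun i => ?_) _
  exact (continuous_of_discreteTopology (f := digit θ i)).comp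
    ((continuous_apply (i / (ℓ : ℤ))).comp continuous_subtype_val)

omit [NeZero ℓ] [DiscreteTopology A] in
theorem mem_closure_of_windows {S : Set (shiftSpace θ)} {x : shiftSpace θ}
    (h : ∀ N : ℕ, ∃ s ∈ S, ∀ i : ℤ, i.natAbs ≤ N → s.1 i = x.1 i) : x ∈ closure S := by
  rw [mem_closure_iff]
  intro U hU hxU
  obtain ⟨V, hV, rfl⟩ := isOpen_induced_iff.1 hU
  obtain ⟨I, u, hu, huV⟩ := isOpen_pi_iff.1 hV x.1 hxU
  obtain ⟨s, hs, hsx⟩ := h (I.sup Int.natAbs)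
  refine ⟨s, huV fun i hi => ?_, hs⟩
  rw [hsx i (Finset.le_sup (f := Int.natAbs) hi)]
  exact (hu i hi).2

omit [NeZero ℓ] in
theorem isClopen_apply_eq (i : ℤ) (s : Set A) : IsClopen {x : shiftSpace θ | x.1 i ∈ s} :=
  (isClopen_discrete s).preimage ((continuous_apply i).comp continuous_subtype_val)

variable [Finite A]

omit [NeZero ℓ] [Finite A] in
theorem isClosed_shiftSpace : IsClosed (shiftSpace θ) := by
  have h : shiftSpace θ = ⋂ (i : ℤ) (n : ℕ),
      (fun (x : ℤ → A) (j : Fin n) => x (i + (j : ℕ))) ⁻¹' {w | Allowed θ (List.ofFn w)} := by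
    ext x
    simp [shiftSpace]
  rw [h]
  refine isClosed_iInter fun i => isClosed_iInter fun n => ?_
  exact (isClosed_discrete _).preimage (continuous_pi fun j => continuous_apply _)

instance : CompactSpace (shiftSpace θ) := isCompact_iff_compactSpace.1 isClosed_shiftSpace.isCompact

theorem isClosed_isLevel (n : ℕ) (k : ℤ) : IsClosed {x | IsLevel θ n k x} :=
  (isCompact_range ((continuous_shift θ k).comp (continuous_substMap.iterate n))).isClosed

namespace IsAdmissible

omit [DiscreteTopology A] [Finite A] in
theorem dense_orbit (h : IsAdmissible θ) {z : shiftSpace θ} (hz : substSeq θ z.1 = z.1) :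
    Dense (Set.range fun t => shift θ t z) := by
  intro x
  refine mem_closure_of_windows fun N => ?_
  obtain ⟨a, k, p, hp, hpn, hw⟩ := (mem_shiftSpace_iff θ).1 x.2 (-N) (2 * N + 1)
  obtain ⟨K, hK⟩ := h.prim
  obtain ⟨q, hq0, hq, hqa⟩ := (mem_powWord θ).1 (hK (z.1 0) a)
  push_cast at hpn hw
  have hz1 : z.1 q = a := by
    rw [IsFixed.apply hz K q, Int.ediv_eq_zero_of_lt hq0 hq, hqa]
  refine ⟨_, ⟨q * (ℓ : ℤ) ^ k + p + N, rfl⟩, fun i hi => ?_⟩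
  have h1 := hw (i + N) (by omega) (by omega)
  rw [neg_add_cancel_comm_assoc] at h1
  rw [h1]
  change z.1 (i + (q * (ℓ : ℤ) ^ k + p + N)) = _
  have h2 : i + (q * (ℓ : ℤ) ^ k + p + N) = p + (i + N) + q * (ℓ : ℤ) ^ k := by ring
  rw [IsFixed.apply hz k, h2, Int.add_mul_ediv_right _ _ (length_pow_pos k).ne',
    Int.ediv_eq_zero_of_lt (by omega) (by omega), zero_add, hz1]
  exact congrFun (col_congr θ ⟨q, by ring⟩) a

omit [TopologicalSpace A] [DiscreteTopology A] in
theorem exists_fixed_point (h : IsAdmissible θ) : ∃ z : shiftSpace θ, substSeq θ z.1 = z.1 := by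
  obtain ⟨a, a', b, -, hab, -⟩ := h.exists_two_pred
  obtain ⟨x, hx, hfix, -⟩ := h.exists_fixed hab
  exact ⟨⟨x, hx⟩, hfix⟩

theorem exists_isLevel (h : IsAdmissible θ) (n : ℕ) (x : shiftSpace θ) :
    ∃ k, IsLevel θ n k x := by
  obtain ⟨z, hz⟩ := h.exists_fixed_point
  have hclosed : IsClosed (⋃ k ∈ Finset.Ico 0 ((ℓ : ℤ) ^ n), {x | IsLevel θ n k x}) :=
    (Finset.finite_toSet _).isClosed_biUnion fun k _ => isClosed_isLevel n k
  have hsub : (Set.range fun t => QuasiBij.shift θ t z) ⊆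
      ⋃ k ∈ Finset.Ico 0 ((ℓ : ℤ) ^ n), {x | IsLevel θ n k x} := by
    rintro _ ⟨t, rfl⟩
    have hpos := length_pow_pos (ℓ := ℓ) n
    have h1 : IsLevel θ n t (QuasiBij.shift θ t z) := by
      refine ⟨z, ?_⟩
      rw [Function.iterate_fixed (Subtype.ext hz : substMap θ z = z)]
    refine Set.mem_iUnion₂.2 ⟨t % (ℓ : ℤ) ^ n, ?_, h1.congr Int.dvd_self_sub_emod⟩
    exact Finset.mem_Ico.2 ⟨Int.emod_nonneg _ hpos.ne', Int.emod_lt_of_pos _ hpos⟩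
  have hx : x ∈ closure (Set.range fun t => QuasiBij.shift θ t z) := h.dense_orbit hz x
  obtain ⟨k, -, hk⟩ := Set.mem_iUnion₂.1 (closure_minimal hsub hclosed hx)
  exact ⟨k, hk⟩

theorem exists_mem_range_digit (h : IsAdmissible θ) (x : shiftSpace θ) :
    ∃ k, ∀ j, x.1 j ∈ Set.range (digit θ (j + k)) := by
  obtain ⟨k, hk⟩ := h.exists_isLevel 1 x
  obtain ⟨y, hy⟩ := hk.exists_apply
  exact ⟨k, fun j => ⟨_, by rw [hy, col_one]⟩⟩

theorem isLevel_unique (h : IsAdmissible θ) {n : ℕ} {k k' : ℤ} {x : shiftSpace θ}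
    (hk : IsLevel θ n k x) (hk' : IsLevel θ n k' x) : (ℓ : ℤ) ^ n ∣ k' - k := by
  obtain ⟨y, hy⟩ := hk.exists_apply
  obtain ⟨y', hy'⟩ := hk'.exists_apply
  obtain ⟨m, hm⟩ := h.exists_mem_range_digit y
  obtain ⟨m', hm'⟩ := h.exists_mem_range_digit y'
  refine h.dvd_of_iterate_eq (x := (QuasiBij.shift θ (-k) x).1) (Subtype.prop _) hm hm'
    (fun i => ?_) fun i => ?_
  · change x.1 (i + -k) = _
    rw [hy, neg_add_cancel_right]
  · change x.1 (i + -k) = _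
    rw [hy', add_assoc, neg_add_eq_sub]

end IsAdmissible

end Topology

end Recognizability

section LadicInt

variable {ℓ : ℕ}

theorem ladicInt_intCast_val (t : ℤ) (n : ℕ) : (t : ladicInt ℓ).1 n = t := rfl

theorem ladicInt_val_eq_of_le {z : ladicInt ℓ} {n : ℕ} {t : ℤ} (h : z.1 n = t) {m : ℕ}
    (hm : m ≤ n) : z.1 m = t := by
  induction n, hm using Nat.le_induction with
  | base => exact h
  | succ n _ ih =>
    apply ih
    rw [← z.2 n, h, map_intCast]

theorem mem_of_isClosed_of_intCast_mem {C : Set (ladicInt ℓ)} (hC : IsClosed C)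
    (h : ∀ t : ℤ, (t : ladicInt ℓ) ∈ C) (z : ladicInt ℓ) : z ∈ C := by
  rw [← hC.closure_eq, mem_closure_iff]
  intro U hU hzU
  obtain ⟨V, hV, rfl⟩ := isOpen_induced_iff.1 hU
  obtain ⟨I, u, hu, huV⟩ := isOpen_pi_iff.1 hV z.1 hzU
  obtain ⟨t, ht⟩ := ZMod.intCast_surjective (z.1 (I.sup id))
  refine ⟨t, huV fun n hn => ?_, h t⟩
  rw [ladicInt_intCast_val, ← ladicInt_val_eq_of_le ht.symm (Finset.le_sup (f := id) hn)]
  exact (hu n hn).2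

end LadicInt

section FactorMap

variable {A : Type*} {ℓ : ℕ} [NeZero ℓ] {θ : A → Fin ℓ → A}
  [TopologicalSpace A] [DiscreteTopology A]

omit [DiscreteTopology A] in
theorem IsFactorMap.apply_shift {π : shiftSpace θ → ladicInt ℓ} (hπ : IsFactorMap θ π) (t : ℤ)
    (x : shiftSpace θ) : π (shift θ t x) = π x + t := by
  have hadd : ∀ s t, shift θ s (shift θ t x) = shift θ (s + t) x := fun s t =>
    congrFun (shift_comp θ s t) x
  induction t using Int.induction_on with
  | zero =>
    have : shift θ 0 x = x := Subtype.ext (funext fun i => congrArg x.1 (add_zero i))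
    simp [this]
  | succ t ih =>
    rw [add_comm, ← hadd, hπ.equivariant, ih]
    push_cast
    ring
  | pred t ih =>
    have h := hπ.equivariant (shift θ (-t - 1) x)
    rw [hadd, add_sub_cancel, ih] at h
    rw [← sub_eq_iff_eq_add] at h
    rw [← h]
    push_cast
    ring

namespace IsAdmissible

variable [Finite A]

/-- The address of a point: its class modulo `ℓ ^ n` is the position of the cutting points of the
decomposition into the words `θ ^ n (a)`. -/
noncomputable def address (h : IsAdmissible θ) (x : shiftSpace θ) : ladicInt ℓ :=
  ⟨fun n => ((h.exists_isLevel n x).choose : ℤ), fun n => by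
    rw [map_intCast, ZMod.intCast_eq_intCast_iff_dvd_sub]
    push_cast
    exact h.isLevel_unique (h.exists_isLevel (n + 1) x).choose_spec.of_succ
      (h.exists_isLevel n x).choose_spec⟩

theorem address_eq_iff (h : IsAdmissible θ) {x : shiftSpace θ} {n : ℕ} {k : ℤ} :
    (h.address x).1 n = k ↔ IsLevel θ n k x := by
  have hx := (h.exists_isLevel n x).choose_spec
  constructor
  · intro hk
    have hk : (((h.exists_isLevel n x).choose : ℤ) : ZMod (ℓ ^ n)) = k := hk
    refine hx.congr ?_
    rw [← neg_sub, dvd_neg]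
    rw [ZMod.intCast_eq_intCast_iff_dvd_sub] at hk
    exact_mod_cast hk
  · intro hk
    change (((h.exists_isLevel n x).choose : ℤ) : ZMod (ℓ ^ n)) = k
    rw [ZMod.intCast_eq_intCast_iff_dvd_sub]
    exact_mod_cast h.isLevel_unique hx hk

theorem continuous_address (h : IsAdmissible θ) : Continuous h.address := by
  refine Continuous.subtype_mk (continuous_pi fun n => continuous_iff_isClosed.2 fun s _ => ?_) _
  have hs : (fun x => (h.address x).1 n) ⁻¹' s = ⋃ b ∈ s, {x | IsLevel θ n (b.val : ℤ) x} := by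
    ext x
    simp only [Set.mem_preimage, Set.mem_iUnion, Set.mem_ofPred_eq, ← h.address_eq_iff]
    simp
  exact hs ▸ s.toFinite.isClosed_biUnion fun b _ => isClosed_isLevel n _

theorem address_shift (h : IsAdmissible θ) (t : ℤ) (x : shiftSpace θ) :
    h.address (QuasiBij.shift θ t x) = h.address x + t := by
  refine Subtype.ext (funext fun n => ?_)
  obtain ⟨k, hk⟩ := h.exists_isLevel n x
  change (h.address (QuasiBij.shift θ t x)).1 n = (h.address x).1 n + t
  rw [h.address_eq_iff.2 hk, ← Int.cast_add, h.address_eq_iff]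
  exact hk.shift t

omit [TopologicalSpace A] [DiscreteTopology A] in
theorem apply_eq_of_isLevel (h : IsAdmissible θ) {x : shiftSpace θ} (hx : ∀ n, IsLevel θ n 0 x)
    {n : ℕ} {i : ℤ} (hi : i.natAbs ≤ n) : x.1 i = col θ n i (x.1 (i / (ℓ : ℤ) ^ n)) := by
  obtain ⟨h1, h2⟩ := natAbs_lt_length_pow h.two_le_length hi
  obtain ⟨y, hy⟩ := (hx (n + 1)).exists_apply
  simp only [add_zero] at hy
  have hj : ∀ j : ℤ, j = i / (ℓ : ℤ) ^ n → j = 0 ∨ j = -1 := by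
    rintro j rfl
    rcases lt_or_ge i 0 with h | h
    · exact Or.inr (ediv_length_pow_of_neg h h1.le)
    · exact Or.inl (ediv_length_pow_of_nonneg h h2)
  rw [hy i, add_comm n 1, ← col_add_apply, add_comm 1 n, col_one]
  rw [pow_succ, ← Int.ediv_ediv_of_nonneg (length_pow_pos n).le]
  generalize i / (ℓ : ℤ) ^ n = j at *
  congr 1
  rw [hy j]
  rcases hj j rfl with rfl | rfl
  · rw [Int.zero_ediv, Int.zero_ediv, col_zero_right, ← ePlus_eq_digit]
    exact congrFun (IsIdempotentElem.pow_succ_eq n h.ePlus_mul_self).symm _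
  · rw [neg_one_ediv_of_pos length_pos, neg_one_ediv_length_pow, col_neg_one, ← eMinus_eq_digit]
    exact congrFun (IsIdempotentElem.pow_succ_eq n h.eMinus_mul_self).symm _

theorem address_eq_zero_iff (h : IsAdmissible θ) (x : shiftSpace θ) :
    h.address x = 0 ↔ substSeq θ x.1 = x.1 := by
  constructor
  · intro hx
    have hlev : ∀ n, IsLevel θ n 0 x := fun n => by
      rw [← h.address_eq_iff, hx]
      exact Int.cast_zero.symm
    funext i
    rw [substSeq_apply, h.apply_eq_of_isLevel hlev (Nat.le_add_left (i / (ℓ : ℤ)).natAbs i.natAbs),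
      ← ediv_length_pow_succ]
    exact (h.apply_eq_of_isLevel hlev
      (show i.natAbs ≤ i.natAbs + (i / (ℓ : ℤ)).natAbs + 1 by omega)).symm
  · intro hx
    refine Subtype.ext (funext fun n => ?_)
    have h1 : IsLevel θ n 0 x := ⟨x, by
      rw [Function.iterate_fixed (Subtype.ext hx : substMap θ x = x)]
      exact Subtype.ext (funext fun i => congrArg x.1 (add_zero i))⟩
    rw [h.address_eq_iff.2 h1]
    exact Int.cast_zero

theorem isFactorMap_address (h : IsAdmissible θ) : IsFactorMap θ h.address where
  continuous := h.continuous_address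
  surjective := by
    obtain ⟨z, hz⟩ := h.exists_fixed_point
    refine mem_of_isClosed_of_intCast_mem (C := Set.range h.address)
      (isCompact_range h.continuous_address).isClosed fun t => ⟨QuasiBij.shift θ t z, ?_⟩
    rw [h.address_shift, (h.address_eq_zero_iff z).2 hz, zero_add]
  equivariant x := by rw [h.address_shift, Int.cast_one]
  zero_iff := h.address_eq_zero_iff

theorem existsUnique_factorMap (h : IsAdmissible θ) :
    ∃! π : shiftSpace θ → ladicInt ℓ, IsFactorMap θ π := by
  refine ⟨h.address, h.isFactorMap_address, fun π hπ => ?_⟩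
  obtain ⟨z, hz⟩ := h.exists_fixed_point
  refine Continuous.ext_on (h.dense_orbit hz) hπ.continuous h.continuous_address ?_
  rintro _ ⟨t, rfl⟩
  rw [hπ.apply_shift, h.address_shift, (hπ.zero_iff z).2 hz, (h.address_eq_zero_iff z).2 hz]

end IsAdmissible

end FactorMap

section EllisKernel

variable {X : Type*} [TopologicalSpace X] [CompactSpace X] [T2Space X]

/-- A compact semigroup of maps has a minimal left ideal. -/
theorem exists_minimal_left_ideal {E : Set (X → X)} (hE : IsClosed E) (hne : E.Nonempty)
    (hmul : ∀ f ∈ E, ∀ g ∈ E, f ∘ g ∈ E) :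
    ∃ L ⊆ E, L.Nonempty ∧ (∀ f ∈ E, ∀ l ∈ L, f ∘ l ∈ L) ∧
      ∀ l ∈ L, ∀ l' ∈ L, ∃ q ∈ E, l' = q ∘ l := by
  let S : Set (Set (X → X)) :=
    {L | IsClosed L ∧ L.Nonempty ∧ L ⊆ E ∧ ∀ f ∈ E, ∀ l ∈ L, f ∘ l ∈ L}
  obtain ⟨L, hL⟩ : ∃ L, Minimal (· ∈ S) L := by
    refine zorn_superset S fun c hcS hc => ?_
    rcases c.eq_empty_or_nonempty with rfl | hcne
    · exact ⟨E, ⟨hE, hne, subset_rfl, hmul⟩, by simp⟩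
    · have : Nonempty c := hcne.to_subtype
      refine ⟨⋂₀ c, ⟨isClosed_sInter fun s hs => (hcS hs).1, ?_, ?_, ?_⟩,
        fun s hs => Set.sInter_subset_of_mem hs⟩
      · exact IsCompact.nonempty_sInter_of_directed_nonempty_isCompact_isClosed
          (fun s hs t ht => (hc.total hs ht).elim (fun h => ⟨s, hs, subset_rfl, h⟩)
            fun h => ⟨t, ht, h, subset_rfl⟩) (fun s hs => (hcS hs).2.1) (fun s hs => (hcS hs).1.isCompact)
          fun s hs => (hcS hs).1
      · obtain ⟨s, hs⟩ := hcne
        exact (Set.sInter_subset_of_mem hs).trans (hcS hs).2.2.1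
      · exact fun f hf l hl s hs => (hcS hs).2.2.2 f hf l (hl s hs)
  obtain ⟨hLc, hLne, hLE, hLmul⟩ := hL.prop
  refine ⟨L, hLE, hLne, hLmul, fun l hl l' hl' => ?_⟩
  have hcont : Continuous fun q : X → X => q ∘ l := continuous_pi fun x => continuous_apply (l x)
  have hmem : (fun q : X → X => q ∘ l) '' E ∈ S := by
    refine ⟨(hE.isCompact.image hcont).isClosed, hne.image _, ?_, ?_⟩
    · rintro _ ⟨q, hq, rfl⟩
      exact hmul q hq l (hLE hl)
    · rintro f hf _ ⟨q, hq, rfl⟩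
      exact ⟨f ∘ q, hmul f hf q hq, rfl⟩
  have hsub : (fun q : X → X => q ∘ l) '' E ⊆ L := by
    rintro _ ⟨q, hq, rfl⟩
    exact hLmul q hq l hl
  obtain ⟨q, hq, hql⟩ := hL.le_of_le hmem hsub hl'
  exact ⟨q, hq, hql.symm⟩

theorem kernel_nonempty {E : Set (X → X)} (hE : IsClosed E) (hne : E.Nonempty)
    (hmul : ∀ f ∈ E, ∀ g ∈ E, f ∘ g ∈ E) : (kernel E).Nonempty := by
  obtain ⟨L, hLE, ⟨l, hl⟩, hLmul, hLmin⟩ := exists_minimal_left_ideal hE hne hmul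
  refine ⟨l, hLE hl, fun J ⟨⟨j, hj⟩, hJE, hJ⟩ => ?_⟩
  obtain ⟨q, hq, hql⟩ := hLmin (j ∘ l) (hLmul j (hJE hj) l hl) l hl
  rw [hql]
  exact (hJ q hq _ (hJ l (hLE hl) j hj).2).1

theorem exists_eq_comp_of_mem_kernel {E : Set (X → X)} (hE : IsClosed E)
    (hmul : ∀ f ∈ E, ∀ g ∈ E, f ∘ g ∈ E) {f p : X → X} (hf : f ∈ kernel E) (hp : p ∈ E) :
    ∃ q ∈ E, f = q ∘ p ∘ f := by
  obtain ⟨L, hLE, ⟨l, hl⟩, hLmul, hLmin⟩ := exists_minimal_left_ideal hE ⟨p, hp⟩ hmul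
  have hJ : IsBilateralIdeal E {f | ∃ l ∈ L, ∃ r ∈ E, f = l ∘ r} := by
    refine ⟨⟨l ∘ p, l, hl, p, hp, rfl⟩, ?_, ?_⟩
    · rintro _ ⟨l, hl, r, hr, rfl⟩
      exact hmul l (hLE hl) r hr
    · rintro s hs _ ⟨l, hl, r, hr, rfl⟩
      exact ⟨⟨s ∘ l, hLmul s hs l hl, r, hr, rfl⟩, ⟨l, hl, r ∘ s, hmul r hr s hs, rfl⟩⟩
  obtain ⟨l, hl, r, hr, rfl⟩ := hf.2 _ hJ
  obtain ⟨q, hq, hql⟩ := hLmin (p ∘ l) (hLmul p hp l hl) l hl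
  refine ⟨q, hq, ?_⟩
  conv_lhs => rw [hql]
  rfl

omit [TopologicalSpace X] [CompactSpace X] [T2Space X] in
theorem comp_mem_kernel {E : Set (X → X)} (hmul : ∀ f ∈ E, ∀ g ∈ E, f ∘ g ∈ E) {f g : X → X}
    (hf : f ∈ E) (hg : g ∈ kernel E) : f ∘ g ∈ kernel E ∧ g ∘ f ∈ kernel E :=
  ⟨⟨hmul f hf g hg.1, fun J hJ => (hJ.2.2 f hf g (hg.2 J hJ)).1⟩,
    ⟨hmul g hg.1 f hf, fun J hJ => (hJ.2.2 f hf g (hg.2 J hJ)).2⟩⟩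

end EllisKernel

section EllisShift

variable {A : Type*} {ℓ : ℕ} [NeZero ℓ] {θ : A → Fin ℓ → A}
  [TopologicalSpace A] [DiscreteTopology A] [Finite A]

omit [NeZero ℓ] [DiscreteTopology A] [Finite A] in
theorem ellis_shift_comp : ∀ f ∈ ellis (shift θ), ∀ g ∈ ellis (shift θ),
    f ∘ g ∈ ellis (shift θ) :=
  fun _ hf _ hg => ellis_comp (continuous_shift θ) (shift_comp θ) hf hg

omit [TopologicalSpace A] [DiscreteTopology A] [Finite A] in
theorem apply_eq_of_fixed {x : ℤ → A} (hx : substSeq θ x = x) {j : ℤ} (hj : j / ℓ = j) :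
    digit θ j (x j) = x j := by
  conv_rhs => rw [← hx, substSeq_apply, hj]

namespace IsAdmissible

theorem address_sub_address (h : IsAdmissible θ) {f : shiftSpace θ → shiftSpace θ}
    (hf : f ∈ ellis (QuasiBij.shift θ)) (x y : shiftSpace θ) :
    h.address (f x) - h.address x = h.address (f y) - h.address y := by
  have hc : ∀ x, Continuous fun f : shiftSpace θ → shiftSpace θ => h.address (f x) :=
    fun x => h.continuous_address.comp (continuous_apply x)
  refine closure_minimal (t := {f | h.address (f x) - h.address x = h.address (f y) - h.address y})
    ?_ (isClosed_eq ((hc x).sub continuous_const) ((hc y).sub continuous_const)) hf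
  rintro _ ⟨t, rfl⟩
  simp [h.address_shift]

/-- Some element of the kernel of the Ellis semigroup preserves the fibres. -/
theorem kernelFib_nonempty (h : IsAdmissible θ) : (kernelFib θ h.address).Nonempty := by
  obtain ⟨z, hz⟩ := h.exists_fixed_point
  rw [← h.address_eq_zero_iff] at hz
  have hE : IsClosed (ellis (QuasiBij.shift θ)) := isClosed_closure
  obtain ⟨u, hu⟩ := kernel_nonempty hE (Set.range_nonempty _).closure ellis_shift_comp
  have hc : Continuous fun f : shiftSpace θ → shiftSpace θ => h.address (f z) :=
    h.continuous_address.comp (continuous_apply z)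
  obtain ⟨v, hv, hvz⟩ := mem_of_isClosed_of_intCast_mem (hE.isCompact.image hc).isClosed
    (fun t => ⟨_, subset_closure ⟨t, rfl⟩, by
      change h.address (QuasiBij.shift θ t z) = _
      rw [h.address_shift, hz, zero_add]⟩) (-h.address (u z))
  refine ⟨v ∘ u, (comp_mem_kernel ellis_shift_comp hv hu).1, fun x => ?_⟩
  have h1 := h.address_sub_address hv (u x) z
  have h2 := h.address_sub_address hu.1 x z
  simp only at hvz
  rw [hvz, hz, sub_zero] at h1
  rw [hz, sub_zero] at h2
  rw [Function.comp_apply]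
  linear_combination h1 + h2

theorem eq_of_letters (h : IsAdmissible θ) {x y : shiftSpace θ} (hx : h.address x = 0)
    (hy : h.address y = 0) (h1 : x.1 (-1) = y.1 (-1)) (h0 : x.1 0 = y.1 0) : x = y :=
  Subtype.ext (IsFixed.ext h.two_le_length ((h.address_eq_zero_iff x).1 hx)
    ((h.address_eq_zero_iff y).1 hy) h1 h0)

theorem finite_fibre (h : IsAdmissible θ) : {x | h.address x = 0}.Finite := by
  refine Set.Finite.of_injOn (f := fun x : shiftSpace θ => (x.1 (-1), x.1 0)) (t := Set.univ)
    (fun _ _ => trivial) (fun x hx y hy hxy => ?_) Set.finite_univ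
  simp only [Prod.mk.injEq] at hxy
  exact h.eq_of_letters hx hy hxy.1 hxy.2

/-- A fibre-preserving element of the Ellis semigroup acts on the fibre over `0` either as the
identity or by a pair of consecutive columns. -/
theorem exists_consecutive (h : IsAdmissible θ) {f : shiftSpace θ → shiftSpace θ}
    (hf : f ∈ ellis (QuasiBij.shift θ)) (hfib : ∀ x, h.address (f x) = h.address x) :
    (∀ x, h.address x = 0 → f x = x) ∨ ∃ L R, ∃ j : ℤ, (j = 0 ∨ j = -1) ∧ Consecutive θ L R ∧
      eMinus θ * L = L ∧ ePlus θ * R = R ∧ L * digit θ j = L ∧ R * digit θ j = R ∧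
      ∀ x, h.address x = 0 → (f x).1 (-1) = L (x.1 j) ∧ (f x).1 0 = R (x.1 j) := by
  obtain ⟨z, hz⟩ := h.exists_fixed_point
  rw [← h.address_eq_zero_iff] at hz
  have hev : ∀ x, Continuous fun g : shiftSpace θ → shiftSpace θ => g x := continuous_apply
  have hopen : IsOpen ({g : shiftSpace θ → shiftSpace θ | (h.address (g z)).1 1 = 0} ∩
      ⋂ x ∈ {x | h.address x = 0},
        ({g | (g x).1 (-1) ∈ ({(f x).1 (-1)} : Set A)} ∩
          {g | (g x).1 0 ∈ ({(f x).1 0} : Set A)})) := by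
    refine IsOpen.inter ?_ (h.finite_fibre.isOpen_biInter fun x _ => IsOpen.inter ?_ ?_)
    · exact (isOpen_discrete {0}).preimage ((continuous_apply 1).comp
        (continuous_subtype_val.comp (h.continuous_address.comp (continuous_apply z))))
    · exact (isClopen_apply_eq (-1) {(f x).1 (-1)}).isOpen.preimage (hev x)
    · exact (isClopen_apply_eq 0 {(f x).1 0}).isOpen.preimage (hev x)
  obtain ⟨_, ⟨ht0, ht⟩, t, rfl⟩ := mem_closure_iff.1 hf _ hopen ⟨by
    change (h.address (f z)).1 1 = 0
    rw [hfib, hz]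
    rfl, by simp⟩
  change (h.address (QuasiBij.shift θ t z)).1 1 = 0 at ht0
  rw [h.address_shift, hz, zero_add, ladicInt_intCast_val, ZMod.intCast_zmod_eq_zero_iff_dvd,
    pow_one] at ht0
  obtain ⟨m, rfl⟩ := ht0
  have hl := length_pos (ℓ := ℓ)
  have hft : ∀ x, h.address x = 0 →
      (f x).1 (-1) = eMinus θ (x.1 (m - 1)) ∧ (f x).1 0 = ePlus θ (x.1 m) := by
    intro x hx
    obtain ⟨h1, h0⟩ := Set.mem_iInter₂.1 ht x hx
    have h1 : x.1 (-1 + ℓ * m) = (f x).1 (-1) := h1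
    have h0 : x.1 (0 + ℓ * m) = (f x).1 0 := h0
    have hfix := IsFixed.apply ((h.address_eq_zero_iff x).1 hx) 1
    rw [hfix, pow_one, Int.add_mul_ediv_left _ _ hl.ne', col_one,
      digit_congr θ (j := -1) ⟨m, by ring⟩, ← eMinus_eq_digit, neg_one_ediv_of_pos hl,
      neg_add_eq_sub] at h1
    rw [hfix, pow_one, Int.add_mul_ediv_left _ _ hl.ne', col_one,
      digit_congr θ (j := 0) ⟨m, by ring⟩, ← ePlus_eq_digit, Int.zero_ediv, zero_add] at h0
    exact ⟨h1.symm, h0.symm⟩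
  rcases eq_or_ne m 0 with rfl | hm
  · refine Or.inl fun x hx => h.eq_of_letters ((hfib x).trans hx) hx ?_ ?_
    · rw [(hft x hx).1, zero_sub, eMinus_eq_digit]
      exact apply_eq_of_fixed ((h.address_eq_zero_iff x).1 hx) (neg_one_ediv_of_pos hl)
    · rw [(hft x hx).2, ePlus_eq_digit]
      exact apply_eq_of_fixed ((h.address_eq_zero_iff x).1 hx) (Int.zero_ediv _)
  · right
    set n := m.natAbs + 1 with hn
    obtain ⟨h1, h2⟩ := natAbs_lt_length_pow h.two_le_length (show m.natAbs ≤ n by omega)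
    obtain ⟨h3, h4⟩ := natAbs_lt_length_pow h.two_le_length (show (m - 1).natAbs ≤ n by omega)
    have hdvd : ¬ (ℓ : ℤ) ^ n ∣ m := fun hd =>
      hm (Int.eq_zero_of_abs_lt_dvd hd (abs_lt.2 ⟨h1, h2⟩))
    obtain ⟨j, hj, hj1, hj2⟩ : ∃ j : ℤ, (j = 0 ∨ j = -1) ∧ m / (ℓ : ℤ) ^ n = j ∧
        (m - 1) / (ℓ : ℤ) ^ n = j := by
      rcases lt_or_gt_of_ne hm with h | h
      · exact ⟨-1, Or.inr rfl, ediv_length_pow_of_neg h h1.le,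
          ediv_length_pow_of_neg (by omega) h3.le⟩
      · exact ⟨0, Or.inl rfl, ediv_length_pow_of_nonneg h.le h2,
          ediv_length_pow_of_nonneg (by omega) h4⟩
    have hjl : j / ℓ = j := by
      rcases hj with rfl | rfl
      · exact Int.zero_ediv _
      · exact neg_one_ediv_of_pos hl
    have hjj : digit θ j * digit θ j = digit θ j := by
      rcases hj with rfl | rfl
      · rw [← ePlus_eq_digit, h.ePlus_mul_self]
      · rw [← eMinus_eq_digit, h.eMinus_mul_self]
    refine ⟨_, _, j, hj, (Consecutive.ePlus_eMinus θ hdvd).mul θ (digit_mem θ j), ?_, ?_, ?_, ?_,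
      fun x hx => ?_⟩
    · rw [← mul_assoc, ← mul_assoc, h.eMinus_mul_self]
    · rw [← mul_assoc, ← mul_assoc, h.ePlus_mul_self]
    · rw [mul_assoc, hjj]
    · rw [mul_assoc, hjj]
    · have hfix := (h.address_eq_zero_iff x).1 hx
      have h5 := apply_eq_of_fixed hfix hjl
      rw [(hft x hx).1, (hft x hx).2, IsFixed.apply hfix n m, IsFixed.apply hfix n (m - 1), hj1, hj2]
      constructor
      · conv_lhs => rw [← h5]
        rfl
      · conv_lhs => rw [← h5]
        rfl

/-- Every pair of consecutive columns is realized by a fibre-preserving element of the Ellis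
semigroup. -/
theorem exists_mem_ellis (h : IsAdmissible θ) {L R : Function.End A} (hLR : Consecutive θ L R)
    (hL : eMinus θ * L = L) (hR : ePlus θ * R = R) (j : ℤ) :
    ∃ f ∈ ellis (QuasiBij.shift θ), (∀ x, h.address (f x) = h.address x) ∧
      ∀ x, h.address x = 0 → (f x).1 (-1) = L (x.1 j) ∧ (f x).1 0 = R (x.1 j) := by
  obtain ⟨n, -, k, hk, rfl, rfl⟩ := (consecutive_iff θ).1 hLR
  have hpos := length_pow_pos (ℓ := ℓ) n
  have hk0 := Int.emod_nonneg k hpos.ne'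
  have hk1 := Int.emod_lt_of_pos k hpos
  have hk2 : k % (ℓ : ℤ) ^ n ≠ 0 := fun h => hk (Int.dvd_of_emod_eq_zero h)
  set q := j * (ℓ : ℤ) ^ n + k % (ℓ : ℤ) ^ n with hq
  have hdvd : (ℓ : ℤ) ^ n ∣ q - k := by
    rw [hq, add_sub_assoc]
    exact dvd_add (dvd_mul_left _ _) (dvd_sub_comm.1 Int.dvd_self_sub_emod)
  have hq1 : q / (ℓ : ℤ) ^ n = j := by
    rw [hq, add_comm, Int.add_mul_ediv_right _ _ hpos.ne', Int.ediv_eq_zero_of_lt hk0 hk1, zero_add]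
  have hq2 : (q - 1) / (ℓ : ℤ) ^ n = j := by
    rw [hq, add_sub_assoc, add_comm, Int.add_mul_ediv_right _ _ hpos.ne',
      Int.ediv_eq_zero_of_lt (by omega) (by omega), zero_add]
  have hpowM : ∀ N, eMinus θ ^ N * col θ n (k - 1) = col θ n (k - 1) := by
    intro N
    induction N with
    | zero => rw [pow_zero, one_mul]
    | succ N ih => rw [pow_succ, mul_assoc, hL, ih]
  have hpowP : ∀ N, ePlus θ ^ N * col θ n k = col θ n k := by
    intro N
    induction N with
    | zero => rw [pow_zero, one_mul]
    | succ N ih => rw [pow_succ, mul_assoc, hR, ih]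
  have hletters : ∀ (N : ℕ) (x : shiftSpace θ), h.address x = 0 →
      x.1 (-1 + (ℓ : ℤ) ^ N * q) = col θ n (k - 1) (x.1 j) ∧
        x.1 (0 + (ℓ : ℤ) ^ N * q) = col θ n k (x.1 j) := by
    intro N x hx
    have hfix := (h.address_eq_zero_iff x).1 hx
    have hN := length_pow_pos (ℓ := ℓ) N
    constructor
    · rw [IsFixed.apply hfix N, Int.add_mul_ediv_left _ _ hN.ne', neg_one_ediv_length_pow,
        col_congr θ (i := -1 + (ℓ : ℤ) ^ N * q) (j := -1) ⟨q, by ring⟩, col_neg_one,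
        neg_add_eq_sub, IsFixed.apply hfix n, hq2,
        col_congr θ (i := q - 1) (j := k - 1) (by rwa [sub_sub_sub_cancel_right])]
      exact congrFun (hpowM N) _
    · rw [IsFixed.apply hfix N, Int.add_mul_ediv_left _ _ hN.ne', Int.zero_ediv,
        col_congr θ (i := 0 + (ℓ : ℤ) ^ N * q) (j := 0) ⟨q, by ring⟩, col_zero_right,
        zero_add, IsFixed.apply hfix n, hq1, col_congr θ hdvd]
      exact congrFun (hpowP N) _
  let u : ℕ → shiftSpace θ → shiftSpace θ := fun N => QuasiBij.shift θ ((ℓ : ℤ) ^ N * q)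
  have hcomp : IsCompact (ellis (QuasiBij.shift θ)) := isClosed_closure.isCompact
  obtain ⟨f, hf, hlim⟩ := hcomp.ultrafilter_le_nhds ((Filter.hyperfilter ℕ).map u)
    (Filter.tendsto_principal.2 (Filter.Eventually.of_forall fun N =>
      subset_closure ⟨(ℓ : ℤ) ^ N * q, rfl⟩))
  have hev : ∀ x, Continuous fun g : shiftSpace θ → shiftSpace θ => g x := continuous_apply
  have hlim : Filter.Tendsto u (Filter.hyperfilter ℕ) (nhds f) := hlim
  refine ⟨f, hf, fun x => Subtype.ext (funext fun M => ?_), fun x hx => ?_⟩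
  · have hcl : IsClosed {g : shiftSpace θ → shiftSpace θ |
        (h.address (g x)).1 M ∈ ({(h.address x).1 M} : Set (ZMod (ℓ ^ M)))} :=
      (isClosed_discrete _).preimage ((continuous_apply M).comp
        (continuous_subtype_val.comp (h.continuous_address.comp (continuous_apply x))))
    refine hcl.mem_of_tendsto hlim (Filter.Eventually.filter_mono
      Nat.hyperfilter_le_atTop (Filter.eventually_atTop.2 ⟨M, fun N hN => ?_⟩))
    change (h.address (QuasiBij.shift θ ((ℓ : ℤ) ^ N * q) x)).1 M = _
    rw [h.address_shift]
    change (h.address x).1 M + ((((ℓ : ℤ) ^ N * q : ℤ)) : ZMod (ℓ ^ M)) = _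
    rw [(ZMod.intCast_zmod_eq_zero_iff_dvd _ _).2, add_zero]
    push_cast
    exact (pow_dvd_pow _ hN).mul_right _
  · constructor
    · exact ((isClopen_apply_eq (-1) {col θ n (k - 1) (x.1 j)}).isClosed.preimage
        (hev x)).mem_of_tendsto hlim
        (Filter.Eventually.of_forall fun N => (hletters N x hx).1)
    · exact ((isClopen_apply_eq 0 {col θ n k (x.1 j)}).isClosed.preimage
        (hev x)).mem_of_tendsto hlim
        (Filter.Eventually.of_forall fun N => (hletters N x hx).2)

end IsAdmissible

end EllisShift

section MatrixSemigroup

variable {A : Type*} {ℓ : ℕ} [NeZero ℓ] {θ : A → Fin ℓ → A} [Finite A]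

namespace IsAdmissible

theorem mem_corner_plus_plus (h : IsAdmissible θ) {s : Function.End A} :
    s ∈ structureGroup θ ↔ s ∈ colSemigroup θ ∧ ePlus θ * s = s ∧ s * ePlus θ = s :=
  mem_corner_iff (ePlus_mem θ) h.ePlus_mul_self (ePlus_mem θ) h.ePlus_mul_self

theorem mem_corner_minus_plus (h : IsAdmissible θ) {s : Function.End A} :
    s ∈ corner θ (eMinus θ) (ePlus θ) ↔
      s ∈ colSemigroup θ ∧ eMinus θ * s = s ∧ s * ePlus θ = s :=
  mem_corner_iff (eMinus_mem θ) h.eMinus_mul_self (ePlus_mem θ) h.ePlus_mul_self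

theorem mem_corner_plus_minus (h : IsAdmissible θ) {s : Function.End A} :
    s ∈ corner θ (ePlus θ) (eMinus θ) ↔
      s ∈ colSemigroup θ ∧ ePlus θ * s = s ∧ s * eMinus θ = s :=
  mem_corner_iff (ePlus_mem θ) h.ePlus_mul_self (eMinus_mem θ) h.eMinus_mul_self

theorem ePlus_mem_structureGroup (h : IsAdmissible θ) : ePlus θ ∈ structureGroup θ :=
  h.mem_corner_plus_plus.2 ⟨ePlus_mem θ, h.ePlus_mul_self, h.ePlus_mul_self⟩

theorem isGroupWithOne (h : IsAdmissible θ) :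
    IsGroupWithOne (⟨ePlus θ, h.ePlus_mem_structureGroup⟩ : structureGroup θ) := by
  refine ⟨fun g => ?_, fun g => ?_⟩
  · obtain ⟨-, h1, h2⟩ := h.mem_corner_plus_plus.1 g.2
    exact ⟨Subtype.ext h1, Subtype.ext h2⟩
  · obtain ⟨q, hq, h1, h2⟩ := exists_inverse_of_mem_corner_self h.simp (ePlus_mem θ)
      h.ePlus_mul_self g.2
    exact ⟨⟨q, hq⟩, Subtype.ext h1, Subtype.ext h2⟩

theorem mem_corner_of_mem_rowSet (h : IsAdmissible θ) {i : Function.End A} (hi : i ∈ rowSet θ) :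
    i ∈ corner θ (eMinus θ) (ePlus θ) := by
  obtain ⟨L, R, Q, ⟨-, hL, -⟩, hQ, -, -, rfl⟩ := hi
  obtain ⟨hLS, hL1, -⟩ := h.mem_corner_minus_plus.1 hL
  obtain ⟨hQS, -, hQ2⟩ := h.mem_corner_plus_plus.1 hQ
  exact h.mem_corner_minus_plus.2
    ⟨mul_mem hLS hQS, by rw [← mul_assoc, hL1], by rw [mul_assoc, hQ2]⟩

theorem consecutive_of_mem_rowSet (h : IsAdmissible θ) {i s : Function.End A} (hi : i ∈ rowSet θ)
    (hs : s ∈ colSemigroup θ) (hes : ePlus θ * s = s) : Consecutive θ (i * s) s := by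
  obtain ⟨L, R, Q, ⟨hLR, -, -⟩, hQ, hRQ, -, rfl⟩ := hi
  have h1 := hLR.mul θ (mul_mem (h.mem_corner_plus_plus.1 hQ).1 hs)
  simp only [← mul_assoc, hRQ, hes] at h1
  exact h1

theorem exists_mem_rowSet (h : IsAdmissible θ) {L R e : Function.End A}
    (he : e ∈ colSemigroup θ) (hee : e * e = e) (hLR : Consecutive θ L R)
    (hL : eMinus θ * L = L) (hR : ePlus θ * R = R) (hLe : L * e = L) (hRe : R * e = R)
    (hLS : L ∈ colSemigroup θ) (hRS : R ∈ colSemigroup θ) : ∃ i ∈ rowSet θ, L = i * R := by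
  obtain ⟨q, hq, hRq, hqR⟩ := exists_inverse_of_mem_corner h.simp (ePlus_mem θ) h.ePlus_mul_self
    he hee ((mem_corner_iff (ePlus_mem θ) h.ePlus_mul_self he hee).2 ⟨hRS, hR, hRe⟩)
  obtain ⟨hqS, -, hq2⟩ := (mem_corner_iff he hee (ePlus_mem θ) h.ePlus_mul_self).1 hq
  have hLR' := hLR.mul θ hqS
  rw [hRq] at hLR'
  refine ⟨L * q, ⟨L * q, ePlus θ, ePlus θ, ⟨hLR', ?_, h.ePlus_mem_structureGroup⟩,
    h.ePlus_mem_structureGroup, h.ePlus_mul_self, h.ePlus_mul_self, ?_⟩, ?_⟩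
  · exact h.mem_corner_minus_plus.2
      ⟨mul_mem hLS hqS, by rw [← mul_assoc, hL], by rw [mul_assoc, hq2]⟩
  · rw [mul_assoc, hq2]
  · rw [mul_assoc, hqR, hLe]

end IsAdmissible

omit [Finite A] in
theorem Consecutive.mem {L R : Function.End A} (hLR : Consecutive θ L R) :
    L ∈ colSemigroup θ ∧ R ∈ colSemigroup θ := by
  obtain ⟨n, hn, k, -, hL, hR⟩ := (consecutive_iff θ).1 hLR
  exact ⟨(mem_colSemigroup_iff θ).2 ⟨n, hn, _, hL⟩, (mem_colSemigroup_iff θ).2 ⟨n, hn, _, hR⟩⟩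

namespace IsAdmissible

theorem rowSet_nonempty (h : IsAdmissible θ) : (rowSet θ).Nonempty := by
  have hdvd : ¬ (ℓ : ℤ) ^ 1 ∣ 1 := fun hd => by
    have h1 := Int.le_of_dvd one_pos hd
    have h2 : (2 : ℤ) ≤ ℓ := by exact_mod_cast h.two_le_length
    rw [pow_one] at h1
    omega
  have hLR := (Consecutive.ePlus_eMinus θ hdvd).mul θ (ePlus_mem θ)
  obtain ⟨i, hi, -⟩ := h.exists_mem_rowSet (ePlus_mem θ) h.ePlus_mul_self hLR
    (by rw [← mul_assoc, ← mul_assoc, h.eMinus_mul_self])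
    (by rw [← mul_assoc, ← mul_assoc, h.ePlus_mul_self])
    (by rw [mul_assoc, h.ePlus_mul_self]) (by rw [mul_assoc, h.ePlus_mul_self])
    hLR.mem.1 hLR.mem.2
  exact ⟨i, hi⟩

omit [Finite A] in
theorem corner_nonempty (θ : A → Fin ℓ → A) : (corner θ (ePlus θ) (eMinus θ)).Nonempty :=
  ⟨_, ePlus θ, ePlus_mem θ, rfl⟩

end IsAdmissible

/-- The position of the letter on which the elements of the column `ε` depend. -/
def PM.pos : PM → ℤ
  | PM.plus => 0
  | PM.minus => -1

/-- The map through which the elements of the column `ε` read this letter. -/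
def PM.reader (θ : A → Fin ℓ → A) (φ : Function.End A) : PM → Function.End A
  | PM.plus => ePlus θ
  | PM.minus => φ

theorem digit_pos_mul_self (h : IsAdmissible θ) (ε : PM) :
    digit θ ε.pos * digit θ ε.pos = digit θ ε.pos := by
  cases ε
  · exact ePlus_eq_digit θ ▸ h.ePlus_mul_self
  · exact eMinus_eq_digit θ ▸ h.eMinus_mul_self

theorem reader_mem (h : IsAdmissible θ) {φ : Function.End A}
    (hφ : φ ∈ corner θ (ePlus θ) (eMinus θ)) (ε : PM) :
    ε.reader θ φ ∈ corner θ (ePlus θ) (digit θ ε.pos) := by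
  cases ε
  · exact ePlus_eq_digit θ ▸ h.ePlus_mem_structureGroup
  · exact eMinus_eq_digit θ ▸ hφ

section Action

variable [TopologicalSpace A] [DiscreteTopology A] (h : IsAdmissible θ)

theorem exists_action {φ : Function.End A} (hφ : φ ∈ corner θ (ePlus θ) (eMinus θ))
    (i : rowSet θ) (g : structureGroup θ) (ε : PM) :
    ∃ f ∈ ellis (shift θ), (∀ x, h.address (f x) = h.address x) ∧
      ∀ x, h.address x = 0 → (f x).1 (-1) = i.1 (g.1 (ε.reader θ φ (x.1 ε.pos))) ∧
        (f x).1 0 = g.1 (ε.reader θ φ (x.1 ε.pos)) := by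
  obtain ⟨hgS, hg1, -⟩ := h.mem_corner_plus_plus.1 g.2
  have hψ := (mem_corner_iff (ePlus_mem θ) h.ePlus_mul_self (digit_mem θ _)
    (digit_pos_mul_self h ε)).1 (reader_mem h hφ ε)
  have hs1 : ePlus θ * (g.1 * ε.reader θ φ) = g.1 * ε.reader θ φ := by rw [← mul_assoc, hg1]
  have hi := h.mem_corner_minus_plus.1 (h.mem_corner_of_mem_rowSet i.2)
  exact h.exists_mem_ellis (h.consecutive_of_mem_rowSet i.2 (mul_mem hgS hψ.1) hs1)
    (by rw [← mul_assoc, hi.2.1]) hs1 ε.pos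

/-- The action of the triple `(i, g, ε)` on the fibre over `0`. -/
noncomputable def action {φ : Function.End A} (hφ : φ ∈ corner θ (ePlus θ) (eMinus θ))
    (i : rowSet θ) (g : structureGroup θ) (ε : PM) :
    Function.End {x : shiftSpace θ // h.address x = 0} := fun x =>
  ⟨(exists_action h hφ i g ε).choose x.1,
    ((exists_action h hφ i g ε).choose_spec.2.1 x.1).trans x.2⟩

variable {h}

theorem action_letters {φ : Function.End A} (hφ : φ ∈ corner θ (ePlus θ) (eMinus θ))
    (i : rowSet θ) (g : structureGroup θ) (ε : PM) (x : {x : shiftSpace θ // h.address x = 0}) :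
    (action h hφ i g ε x).1.1 (-1) = i.1 (g.1 (ε.reader θ φ (x.1.1 ε.pos))) ∧
      (action h hφ i g ε x).1.1 0 = g.1 (ε.reader θ φ (x.1.1 ε.pos)) :=
  (exists_action h hφ i g ε).choose_spec.2.2 x.1 x.2

theorem fibre_ext {x y : {x : shiftSpace θ // h.address x = 0}}
    (h1 : x.1.1 (-1) = y.1.1 (-1)) (h0 : x.1.1 0 = y.1.1 0) : x = y :=
  Subtype.ext (h.eq_of_letters x.2 y.2 h1 h0)

theorem exists_fibre_point (h : IsAdmissible θ) {a b : A} (hab : (a, b) ∈ twoLetter θ) :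
    ∃ x : {x : shiftSpace θ // h.address x = 0}, x.1.1 (-1) = a ∧ x.1.1 0 = b := by
  obtain ⟨x, hx, hfix, h1, h0⟩ := h.exists_fixed hab
  exact ⟨⟨⟨x, hx⟩, (h.address_eq_zero_iff _).2 hfix⟩, h1, h0⟩

theorem exists_fibre_apply_pos (h : IsAdmissible θ) (ε : PM) (c : A) :
    ∃ x : {x : shiftSpace θ // h.address x = 0}, x.1.1 ε.pos = digit θ ε.pos c := by
  cases ε
  · obtain ⟨a, ha⟩ := h.exists_twoLetter_right (congrFun h.ePlus_mul_self c)
    obtain ⟨x, -, hx⟩ := exists_fibre_point h ha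
    exact ⟨x, hx.trans (congrFun (ePlus_eq_digit θ) c)⟩
  · obtain ⟨b, hb⟩ := h.exists_twoLetter_left (congrFun h.eMinus_mul_self c)
    obtain ⟨x, hx, -⟩ := exists_fibre_point h hb
    exact ⟨x, hx.trans (congrFun (eMinus_eq_digit θ) c)⟩

theorem action_mul_action (φ : corner θ (ePlus θ) (eMinus θ))
    (x y : ReesMatrix (sandwich θ h.ePlus_mem_structureGroup φ)) :
    action h φ.2 (x * y).row (x * y).val (x * y).col =
      action h φ.2 x.row x.val x.col * action h φ.2 y.row y.val y.col := by
  obtain ⟨i, g, ε⟩ := x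
  obtain ⟨j, k, ε'⟩ := y
  funext z
  obtain ⟨h1, h0⟩ := action_letters φ.2 i g ε (action h φ.2 j k ε' z)
  obtain ⟨h1', h0'⟩ := action_letters φ.2 j k ε' z
  have key : g.1 (ε.reader θ φ.1 ((action h φ.2 j k ε' z).1.1 ε.pos)) =
      (g * sandwich θ h.ePlus_mem_structureGroup φ ε j * k).1
        (ε'.reader θ φ.1 (z.1.1 ε'.pos)) := by
    cases ε
    · change g.1 (ePlus θ ((action h φ.2 j k ε' z).1.1 0)) = _
      rw [h0']
      rfl
    · change g.1 (φ.1 ((action h φ.2 j k ε' z).1.1 (-1))) = _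
      rw [h1']
      rfl
  obtain ⟨h1'', h0''⟩ := action_letters (h := h) φ.2 i
    (g * sandwich θ h.ePlus_mem_structureGroup φ ε j * k) ε' z
  apply fibre_ext
  · refine h1''.trans (Eq.trans ?_ h1.symm)
    rw [key]
  · exact h0''.trans (key.symm.trans h0.symm)

theorem exists_action_eq_of_mem_kernelFib {φ : Function.End A}
    (hφ : φ ∈ corner θ (ePlus θ) (eMinus θ)) {f : shiftSpace θ → shiftSpace θ}
    (hf : f ∈ kernelFib θ h.address) :
    ∃ i g ε, ∀ x, (action h hφ i g ε x).1 = f x.1 := by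
  have hE : IsClosed (ellis (shift θ)) := isClosed_closure
  rcases h.exists_consecutive hf.1.1 hf.2 with hid | ⟨L, R, j, hj, hLR, hL, hR, hLj, hRj, hact⟩
  · exfalso
    obtain ⟨i, hi⟩ := h.rowSet_nonempty
    obtain ⟨p, hp, hpfib, hpact⟩ :=
      exists_action h hφ ⟨i, hi⟩ ⟨_, h.ePlus_mem_structureGroup⟩ PM.plus
    obtain ⟨q, -, hq⟩ := exists_eq_comp_of_mem_kernel hE ellis_shift_comp hf.1 hp
    obtain ⟨a, a', b, haa, hab, hab'⟩ := h.exists_two_pred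
    obtain ⟨x, hxa, hxb⟩ := exists_fibre_point h hab
    obtain ⟨y, hya, hyb⟩ := exists_fibre_point h hab'
    have hxy : x.1.1 0 = y.1.1 0 := hxb.trans hyb.symm
    have hpxy : p x.1 = p y.1 := by
      obtain ⟨h1, h0⟩ := hpact x.1 x.2
      obtain ⟨h1', h0'⟩ := hpact y.1 y.2
      simp only [PM.pos] at h1 h0 h1' h0'
      refine h.eq_of_letters ((hpfib _).trans x.2) ((hpfib _).trans y.2) ?_ ?_
      · rw [h1, h1', hxy]
      · rw [h0, h0', hxy]
    have hfx : ∀ x : {x : shiftSpace θ // h.address x = 0}, x.1 = q (p x.1) := fun x => by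
      have := congrFun hq x.1
      rwa [Function.comp_apply, Function.comp_apply, hid x.1 x.2] at this
    have : x.1 = y.1 := by rw [hfx x, hpxy, ← hfx y]
    rw [← hxa, ← hya, this] at haa
    exact haa rfl
  · obtain ⟨ε, rfl⟩ : ∃ ε : PM, j = ε.pos := by
      rcases hj with rfl | rfl
      · exact ⟨PM.plus, rfl⟩
      · exact ⟨PM.minus, rfl⟩
    have hdd := digit_pos_mul_self h ε
    have hd := digit_mem θ ε.pos
    obtain ⟨hLS, hRS⟩ := hLR.mem
    obtain ⟨i, hi, hLi⟩ := h.exists_mem_rowSet hd hdd hLR hL hR hLj hRj hLS hRS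
    obtain ⟨q, hq, -, hqψ⟩ := exists_inverse_of_mem_corner h.simp (ePlus_mem θ) h.ePlus_mul_self
      hd hdd (reader_mem h hφ ε)
    obtain ⟨hqS, -, hq2⟩ := (mem_corner_iff hd hdd (ePlus_mem θ) h.ePlus_mul_self).1 hq
    have hg : R * q ∈ structureGroup θ := h.mem_corner_plus_plus.2
      ⟨mul_mem hRS hqS, by rw [← mul_assoc, hR], by rw [mul_assoc, hq2]⟩
    refine ⟨⟨i, hi⟩, ⟨R * q, hg⟩, ε, fun x => ?_⟩
    obtain ⟨h1, h0⟩ := action_letters hφ ⟨i, hi⟩ ⟨R * q, hg⟩ ε x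
    obtain ⟨h1', h0'⟩ := hact x.1 x.2
    have hgψ : (R * q) (ε.reader θ φ (x.1.1 ε.pos)) = R (x.1.1 ε.pos) := by
      change (R * (q * ε.reader θ φ)) (x.1.1 ε.pos) = _
      rw [hqψ, hRj]
    refine h.eq_of_letters (action h hφ ⟨i, hi⟩ ⟨R * q, hg⟩ ε x).2 ((hf.2 _).trans x.2) ?_ ?_
    · rw [h1, h1']
      change i ((R * q) _) = _
      rw [hgψ, hLi]
      rfl
    · rw [h0, h0']
      exact hgψ

theorem action_mem_kernelFibZero (φ : corner θ (ePlus θ) (eMinus θ))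
    (x : ReesMatrix (sandwich θ h.ePlus_mem_structureGroup φ)) :
    action h φ.2 x.row x.val x.col ∈ kernelFibZero θ h.address := by
  obtain ⟨i, g, ε⟩ := x
  obtain ⟨u, hu⟩ := h.kernelFib_nonempty
  obtain ⟨i', g', ε', hu'⟩ := exists_action_eq_of_mem_kernelFib φ.2 hu
  set e : structureGroup θ := ⟨ePlus θ, h.ePlus_mem_structureGroup⟩ with he
  obtain ⟨hone, hinv⟩ := h.isGroupWithOne
  let M := sandwich θ h.ePlus_mem_structureGroup φ
  obtain ⟨k, -, hk⟩ := hinv (M ε i' * g' * M ε' i * e)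
  let p : ReesMatrix M := ⟨i, g * k, ε⟩
  let r : ReesMatrix M := ⟨i', g', ε'⟩
  let q : ReesMatrix M := ⟨i, e, ε⟩
  have hprod : (⟨i, g, ε⟩ : ReesMatrix M) = p * (r * q) := by
    refine ReesMatrix.ext rfl ?_ rfl
    change g = g * k * M ε i' * (g' * M ε' i * e)
    have : g * k * M ε i' * (g' * M ε' i * e) = g * (k * (M ε i' * g' * M ε' i * e)) := by
      simp only [mul_assoc]
    rw [this, hk, (hone g).2]
  rw [hprod, action_mul_action, action_mul_action]
  have hact := fun i g => (exists_action h φ.2 i g ε).choose_spec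
  have hpE := hact p.row p.val
  have hqE := hact q.row q.val
  set fp := (exists_action h φ.2 p.row p.val ε).choose with hfp
  set fq := (exists_action h φ.2 q.row q.val ε).choose with hfq
  refine ⟨fp ∘ (u ∘ fq), ⟨?_, fun x => ?_⟩, fun x => ?_⟩
  · exact (comp_mem_kernel ellis_shift_comp hpE.1
      (comp_mem_kernel ellis_shift_comp hqE.1 hu.1).2).1
  · simp only [Function.comp_apply]
    rw [hpE.2.1, hu.2, hqE.2.1]
  · change fp (action h φ.2 i' g' ε' (action h φ.2 q.row q.val q.col x)).1 = _
    rw [hu']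
    rfl

theorem action_injective (φ : corner θ (ePlus θ) (eMinus θ)) :
    Function.Injective fun x : ReesMatrix (sandwich θ h.ePlus_mem_structureGroup φ) =>
      action h φ.2 x.row x.val x.col := by
  have hmixed : ∀ (g g' : structureGroup θ) (i i' : rowSet θ),
      action h φ.2 i g PM.plus ≠ action h φ.2 i' g' PM.minus := by
    intro g g' i i' heq
    obtain ⟨a, a', b, haa, hab, hab'⟩ := h.exists_two_pred
    obtain ⟨x, hxa, hxb⟩ := exists_fibre_point h hab
    obtain ⟨y, hya, hyb⟩ := exists_fibre_point h hab'
    have hletter : ∀ z : {x : shiftSpace θ // h.address x = 0},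
        g.1 (ePlus θ (z.1.1 0)) = g'.1 (φ.1 (z.1.1 (-1))) := fun z =>
      (action_letters φ.2 i g PM.plus z).2.symm.trans
        ((congrArg (fun w => (w z).1.1 0) heq).trans (action_letters φ.2 i' g' PM.minus z).2)
    obtain ⟨hφS, -, hφ2⟩ := h.mem_corner_plus_minus.1 φ.2
    have hg' := h.mem_corner_plus_plus.1 g'.2
    have h1 : (g'.1 * φ.1) a = (g'.1 * φ.1) a' := by
      have h2 := hletter x
      have h3 := hletter y
      rw [hxa, hxb] at h2
      rw [hya, hyb] at h3
      exact h2.symm.trans h3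
    exact haa (injOn_range h.simp (mul_mem hg'.1 hφS) (eMinus_mem θ)
      ⟨a, (h.mem_twoLetter.1 hab).1⟩ ⟨a', (h.mem_twoLetter.1 hab').1⟩ h1)
  have hsame : ∀ (ε : PM) (g g' : structureGroup θ) (i i' : rowSet θ),
      action h φ.2 i g ε = action h φ.2 i' g' ε → i = i' ∧ g = g' := by
    intro ε g g' i i' heq
    have hdd := digit_pos_mul_self h ε
    have hd := digit_mem θ ε.pos
    have hψ := (mem_corner_iff (ePlus_mem θ) h.ePlus_mul_self hd hdd).1 (reader_mem h φ.2 ε)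
    have hcancel : ∀ s t : Function.End A, s * ePlus θ = s → t * ePlus θ = t →
        (∀ z : {x : shiftSpace θ // h.address x = 0},
          s (ε.reader θ φ.1 (z.1.1 ε.pos)) = t (ε.reader θ φ.1 (z.1.1 ε.pos))) → s = t := by
      intro s t hs ht hst
      obtain ⟨q, -, hq, -⟩ := exists_inverse_of_mem_corner h.simp (ePlus_mem θ) h.ePlus_mul_self
        hd hdd (reader_mem h φ.2 ε)
      have h1 : s * ε.reader θ φ.1 = t * ε.reader θ φ.1 := by
        funext c
        obtain ⟨z, hz⟩ := exists_fibre_apply_pos h ε c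
        have h2 := hst z
        rw [hz] at h2
        rw [← hψ.2.2]
        exact h2
      rw [← hs, ← ht, ← hq, ← mul_assoc, ← mul_assoc, h1]
    have hg : g = g' := by
      refine Subtype.ext (hcancel _ _ (h.mem_corner_plus_plus.1 g.2).2.2
        (h.mem_corner_plus_plus.1 g'.2).2.2 fun z => ?_)
      exact (action_letters φ.2 i g ε z).2.symm.trans
        ((congrArg (fun w => (w z).1.1 0) heq).trans (action_letters φ.2 i' g' ε z).2)
    refine ⟨Subtype.ext ?_, hg⟩
    have hi := h.mem_corner_minus_plus.1 (h.mem_corner_of_mem_rowSet i.2)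
    have hi' := h.mem_corner_minus_plus.1 (h.mem_corner_of_mem_rowSet i'.2)
    obtain ⟨k, hk, -⟩ := h.isGroupWithOne.2 g
    have h1 : i.1 * g.1 = i'.1 * g.1 := by
      have hgp := (h.mem_corner_plus_plus.1 g.2).2.2
      refine hcancel _ _ (by rw [mul_assoc, hgp]) (by rw [mul_assoc, hgp]) fun z => ?_
      have h2 := (action_letters φ.2 i g ε z).1.symm.trans
        ((congrArg (fun w => (w z).1.1 (-1)) heq).trans (action_letters φ.2 i' g' ε z).1)
      rw [← hg] at h2
      exact h2
    have hk : g.1 * k.1 = ePlus θ := congrArg Subtype.val hk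
    rw [← hi.2.2, ← hi'.2.2, ← hk, ← mul_assoc, ← mul_assoc, h1]
  rintro ⟨i, g, ε⟩ ⟨i', g', ε'⟩ heq
  cases ε <;> cases ε'
  · obtain ⟨rfl, rfl⟩ := hsame _ _ _ _ _ heq
    rfl
  · exact absurd heq (hmixed _ _ _ _)
  · exact absurd heq.symm (hmixed _ _ _ _)
  · obtain ⟨rfl, rfl⟩ := hsame _ _ _ _ _ heq
    rfl

/-- The action on the fibre over `0` as an isomorphism of semigroups. -/
noncomputable def actionEquiv (h : IsAdmissible θ) (φ : corner θ (ePlus θ) (eMinus θ)) :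
    ReesMatrix (sandwich θ h.ePlus_mem_structureGroup φ) ≃* kernelFibZero θ h.address :=
  MulEquiv.ofBijective
    ({ toFun := fun x => ⟨action h φ.2 x.row x.val x.col, action_mem_kernelFibZero φ x⟩
       map_mul' := fun x y => Subtype.ext (action_mul_action φ x y) } :
      ReesMatrix (sandwich θ h.ePlus_mem_structureGroup φ) →ₙ* kernelFibZero θ h.address)
    ⟨fun x y hxy => action_injective φ (congrArg Subtype.val hxy), by
      rintro ⟨f, F, hF, hfF⟩
      obtain ⟨i, g, ε, hact⟩ := exists_action_eq_of_mem_kernelFib φ.2 hF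
      exact ⟨⟨i, g, ε⟩, Subtype.ext (funext fun x =>
        Subtype.ext ((hact x).trans (hfF x).symm))⟩⟩

end Action

end MatrixSemigroup

end QuasiBij

open QuasiBij

theorem mainTheorem4 {A : Type*} [Finite A] [TopologicalSpace A] [DiscreteTopology A]
    {ℓ : ℕ} [NeZero ℓ] (θ : A → Fin ℓ → A)
    (hprim : IsPrimitive θ) (haper : IsAperiodic θ) (hqb : IsQuasiBijective θ)
    (hsimp : IsSimplified θ) (hc : 2 ≤ columnRank θ) :
    -- a fixed point is uniquely determined by its letters `a`, `b` at positions `-1`, `0`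
    Set.BijOn (fun x : ℤ → A => (x (-1), x 0))
      {x | x ∈ shiftSpace θ ∧ substSeq θ x = x} (twoLetter θ) ∧
    -- the factor map to the `ℓ`-adic integers exists and is unique
    (∃! π : shiftSpace θ → ladicInt ℓ, IsFactorMap θ π) ∧
    -- the data of the matrix semigroup: a group `G` and a nonempty index set `I`
    (rowSet θ).Nonempty ∧ (corner θ (ePlus θ) (eMinus θ)).Nonempty ∧
    ∃ he : ePlus θ ∈ structureGroup θ,
      IsGroupWithOne (⟨ePlus θ, he⟩ : structureGroup θ) ∧
      ∀ (π : shiftSpace θ → ladicInt ℓ), IsFactorMap θ π →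
      ∀ φ : corner θ (ePlus θ) (eMinus θ),
      ∃ Φ : ReesMatrix (sandwich θ he φ) ≃* kernelFibZero θ π,
        ∀ (i : rowSet θ) (g : structureGroup θ) (x : {x : shiftSpace θ // π x = 0}),
          ((((Φ ⟨i, g, PM.plus⟩).1 x).1.1 (-1) = i.1 (g.1 (x.1.1 0))) ∧
            (((Φ ⟨i, g, PM.plus⟩).1 x).1.1 0 = g.1 (x.1.1 0))) ∧
          ((((Φ ⟨i, g, PM.minus⟩).1 x).1.1 (-1) = i.1 (g.1 (φ.1 (x.1.1 (-1))))) ∧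
            (((Φ ⟨i, g, PM.minus⟩).1 x).1.1 0 = g.1 (φ.1 (x.1.1 (-1))))) := by
  have h : IsAdmissible θ := ⟨hprim, haper, hsimp, hc⟩
  refine ⟨h.bijOn_fixed, h.existsUnique_factorMap, h.rowSet_nonempty,
    IsAdmissible.corner_nonempty θ, h.ePlus_mem_structureGroup, h.isGroupWithOne, fun π hπ φ => ?_⟩
  obtain rfl : π = h.address := h.existsUnique_factorMap.unique hπ h.isFactorMap_address
  refine ⟨actionEquiv h φ, fun i g x => ⟨?_, action_letters φ.2 i g PM.minus x⟩⟩
  obtain ⟨h1, h0⟩ := action_letters φ.2 i g PM.plus x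
  have hg : g.1 (ePlus θ (x.1.1 0)) = g.1 (x.1.1 0) :=
    congrFun (h.mem_corner_plus_plus.1 g.2).2.2 _
  exact ⟨h1.trans (congrArg i.1 hg), h0.trans hg⟩
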